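/- A mixed polynomial in $n$ complex variables is a function $h(\mathbf z,\bar{\mathbf z})$ that is a complex polynomial in the coordinates $z_j$ and their conjugates $\bar z_j$. Lemma. Let $\hat f(z_1,z_2,\bar z_1,\bar z_2)$ be a mixed polynomial in two complex variables, let $g=z_2$, and put $C=\{\hat f=0\}$ and $C'=\{z_2=0\}$ in $\mathbb C^2$. Let $f=\hat f|_{z_2=0}$, a mixed polynomial in the single variable $z_1$, and let $\alpha\in\mathbb C$ be an isolated root of $f$, that is, $f(\alpha)=0$ and $f(z_1)\neq 0$ for all $z_1\ne\alpha$ sufficiently near $\alpha$. Put $\hat\alpha=(\alpha,0)$. Then $\hat\alpha\in C\cap C'$, the point $\hat\alpha$ is isolated in $C\cap C'$, and $$I_{top}(C,C';\hat\alpha)=\mathrm{sm}(f,\alpha)\in\mathbb Z .$$ Here $I_{top}(C,C';\hat\alpha)$ is the local intersection number given by the defining polynomials $\hat f,g$: the mapping degree of $$\varphi/\|\varphi\|:S^3_\varepsilon(\hat\alpha)\to S^3,\qquad \varphi=(\mathrm{Re}\,\hat f,\mathrm{Im}\,\hat f,\mathrm{Re}\,g,\mathrm{Im}\,g):\mathbb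 R^4\to\mathbb R^4,$$ where $\mathbb C^2$ is identified with $\mathbb R^4$ by $(z_1,z_2)\leftrightarrow(x_1,y_1,x_2,y_2)$, $z_j=x_j+iy_j$, and $\varepsilon>0$ is such that $\hat\alpha$ is the only point of $C\cap C'$ in the closed ball of radius $\varepsilon$ around $\hat\alpha$. The multiplicity with sign $\mathrm{sm}(f,\alpha)$ is the mapping degree (winding number) of $f/|f|:S^1_{\varepsilon}(\alpha)\to S^1$, where $\varepsilon>0$ is such that $\alpha$ is the only root of $f$ in the closed disk of radius $\varepsilon$ around $\alpha$. Both numbers do not depend on the choice of such an $\varepsilon$. -/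

import Mathlib

noncomputable section

/-- A mixed polynomial in `n` complex variables: a complex polynomial in the variables
`z_j` (the variable `Sum.inl j`) and their conjugates (the variable `Sum.inr j`). -/
abbrev MixedPolynomial (n : ℕ) : Type := MvPolynomial (Fin n ⊕ Fin n) ℂ

namespace MixedPolynomial

/-- The value `f(z, z̄)` of a mixed polynomial at the point `z ∈ ℂⁿ`. -/
def value {n : ℕ} (f : MixedPolynomial n) (z : Fin n → ℂ) : ℂ :=
  MvPolynomial.eval (Sum.elim z (fun j => star (z j))) f

/-- The zero set of a mixed polynomial in `ℂⁿ`. -/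
def zeroSet {n : ℕ} (f : MixedPolynomial n) : Set (Fin n → ℂ) :=
  {z | f.value z = 0}

/-- The holomorphic coordinate `z₂`, as a mixed polynomial in two variables. -/
def z₂ : MixedPolynomial 2 := MvPolynomial.X (Sum.inl 1)

/-- The restriction `F|_{z₂ = 0}`, a mixed polynomial in the one variable `z₁`:
substitute `0` for `z₂` and for its conjugate. -/
def restrictLine (F : MixedPolynomial 2) : MixedPolynomial 1 :=
  MvPolynomial.bind₁
    (Sum.elim ![MvPolynomial.X (Sum.inl 0), 0] ![MvPolynomial.X (Sum.inr 0), 0]) F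

end MixedPolynomial

/-- The identification `ℝ⁴ → ℂ²`, `(x₁, y₁, x₂, y₂) ↦ (x₁ + i y₁, x₂ + i y₂)`. -/
def toComplexPlane (x : EuclideanSpace ℝ (Fin 4)) : Fin 2 → ℂ :=
  ![⟨x 0, x 1⟩, ⟨x 2, x 3⟩]

/-- The identification `ℂ² → ℝ⁴`, inverse to `toComplexPlane`. -/
def toRealSpace (z : Fin 2 → ℂ) : EuclideanSpace ℝ (Fin 4) :=
  !₂[(z 0).re, (z 0).im, (z 1).re, (z 1).im]

/-- The Jacobian determinant at a unit vector `x` of a map `ψ` from the unit sphere of `ℝᵐ` to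
itself, with respect to the outward orientation and the round metric on both spheres. The
derivative at `x` of the radially constant extension `v ↦ ψ (v / ‖v‖)` is the tangent map of `ψ`
on `xᗮ` and kills `x`; adding `v ↦ ⟪x, v⟫ ψ(x)` sends the outward normal `x` at `x` to the
outward normal `ψ x` at `ψ x`, and leaves the tangent map unchanged on `xᗮ`. -/
def sphereJacobian {m : ℕ} (ψ : EuclideanSpace ℝ (Fin m) → EuclideanSpace ℝ (Fin m))
    (x : EuclideanSpace ℝ (Fin m)) : ℝ :=
  (fderiv ℝ (fun v => ψ (‖v‖⁻¹ • v)) x + (innerSL ℝ x).smulRight (ψ x)).det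

/-- The mapping degree of a smooth map `ψ` of the unit sphere `S` of `ℝᵐ` to itself,
`deg ψ = (∫_S ψ^* ω) / (∫_S ω)` with `ω` the volume form of the sphere: the average of the Jacobian
determinant of `ψ` over the sphere with its surface measure. -/
def mappingDegree {m : ℕ} (ψ : EuclideanSpace ℝ (Fin m) → EuclideanSpace ℝ (Fin m)) : ℝ :=
  ⨍ x, sphereJacobian ψ (x : EuclideanSpace ℝ (Fin m))
    ∂((MeasureTheory.volume : MeasureTheory.Measure (EuclideanSpace ℝ (Fin m))).toSphere)

/-- The map `φ = (Re F, Im F, Re G, Im G) : ℝ⁴ → ℝ⁴`. -/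
def realPair (F G : MixedPolynomial 2) (x : EuclideanSpace ℝ (Fin 4)) :
    EuclideanSpace ℝ (Fin 4) :=
  toRealSpace ![F.value (toComplexPlane x), G.value (toComplexPlane x)]

/-- The normalized map `φ / ‖φ‖ : S_ε(P) → S³`, where `S_ε(P)` is parametrized by
the unit sphere through `x ↦ P + ε x`. -/
def normalizedPair (F G : MixedPolynomial 2) (P : Fin 2 → ℂ) (ε : ℝ)
    (x : EuclideanSpace ℝ (Fin 4)) : EuclideanSpace ℝ (Fin 4) :=
  ‖realPair F G (toRealSpace P + ε • x)‖⁻¹ • realPair F G (toRealSpace P + ε • x)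

/-- `P` is the only common zero of `F` and `G` in the closed ball of radius `ε` around `P`. -/
def IsOnlyIntersection (F G : MixedPolynomial 2) (P : Fin 2 → ℂ) (ε : ℝ) : Prop :=
  ∀ x ∈ Metric.closedBall (toRealSpace P) ε,
    toComplexPlane x ∈ F.zeroSet ∩ G.zeroSet ↔ x = toRealSpace P

/-- `P` is an isolated intersection point of `C : F = 0` and `C' : G = 0`, and the local
intersection number `I_top(C, C'; P)` is well defined and equal to `n`: on every sphere around `P`
bounding a ball in which `P` is the only intersection point, the normalized map of
`(Re F, Im F, Re G, Im G)` has mapping degree `n`. -/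
def HasIntersectionNumber (F G : MixedPolynomial 2) (P : Fin 2 → ℂ) (n : ℤ) : Prop :=
  (∃ ε > 0, IsOnlyIntersection F G P ε) ∧
    ∀ ε > 0, IsOnlyIntersection F G P ε → mappingDegree (normalizedPair F G P ε) = n

/-- The loop `γ : ℝ/2πℤ → S¹` has mapping degree (winding number) `n`: a continuous choice of its
argument grows by `2πn` over one period. -/
def HasWindingNumber (γ : ℝ → ℂ) (n : ℤ) : Prop :=
  ∃ θ : ℝ → ℝ, Continuous θ ∧ (∀ t, γ t = Complex.exp (θ t * Complex.I)) ∧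
    θ (2 * Real.pi) - θ 0 = 2 * Real.pi * n

/-- `α` is the only zero of `f` in the closed disk of radius `ε` around `α`. -/
def IsOnlyRoot (f : MixedPolynomial 1) (α : ℂ) (ε : ℝ) : Prop :=
  ∀ z ∈ Metric.closedBall α ε, f.value ![z] = 0 ↔ z = α

/-- The normalized map `f / |f| : S¹_ε(α) → S¹`, where the circle is parametrized by
`t ↦ α + ε e^{it}`. -/
def normalizedLoop (f : MixedPolynomial 1) (α : ℂ) (ε : ℝ) (t : ℝ) : ℂ :=
  f.value ![circleMap α ε t] / ‖f.value ![circleMap α ε t]‖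

/-- `α` is an isolated root of `f`, and the multiplicity with sign `sm(f, α)` is well defined and
equal to `n`: on every circle around `α` bounding a disk in which `α` is the only root, the
normalized map `f / |f|` has mapping degree `n`. -/
def HasSignedMultiplicity (f : MixedPolynomial 1) (α : ℂ) (n : ℤ) : Prop :=
  (∃ ε > 0, IsOnlyRoot f α ε) ∧
    ∀ ε > 0, IsOnlyRoot f α ε → HasWindingNumber (normalizedLoop f α ε) n

end

open MeasureTheory Set Filter Topology Complex

/-! The degree is computed by integration, with no homotopy. Restrict `φ` to the sphere, rescale the
sphere to radius one, and let `Ψ` be the extension to `ℝ⁴` homogeneous of degree one. Pull back the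
density `(1 + ‖w‖²)⁻³` under `Ψ`. In polar coordinates the integral of the pullback is the mapping
degree times the total mass of the density (`integral_density_radialExtension`).

Since `g = z₂`, the second coordinate of `Ψ` is `ε b`, so `Ψ` maps each plane `b = const` to a
plane. By Fubini it suffices to integrate `(B + |w|²)⁻³`, with `B = 1 + ε²|b|²`, pulled back under a
planar map. This density has the primitive `K(|w|²)(u dv - v du)`, so Green's theorem turns the
integral into a flux through a large circle. As the radius grows, the direction of `(z, b)` tends to
the circle `b = 0`, and `s K(s)` tends to `1 / (4B²)`. The flux therefore tends to `1 / (4B²)` times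
the total change of argument of `f` on the circle of radius `ε` (`integral_fiber`).

Integration over `b` gives a constant independent of `f` and `ε`, which the identity map identifies
(`mappingDegree_fiberedMap`). The change of argument is `2πn` with one integer `n` for all
admissible radii, because it is continuous in the radius (`exists_forall_winding`). -/

/-! ### Green's theorem for a radial density in the plane -/

/-- The radial profile `K` with `2 (s K(s))' = (B + s)⁻³`. -/
noncomputable def fluxProfile (B s : ℝ) : ℝ := (2 * B + s) / (4 * B ^ 2 * (B + s) ^ 2)

theorem hasDerivAt_fluxProfile {B s : ℝ} (hB : 0 < B) (hs : 0 ≤ s) :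
    HasDerivAt (fluxProfile B) (-(3 * B + s) / (4 * B ^ 2 * (B + s) ^ 3)) s := by
  have hBs : B + s ≠ 0 := by positivity
  have h1 : HasDerivAt (fun s : ℝ => 2 * B + s) 1 s := (hasDerivAt_id s).const_add _
  have h2 : HasDerivAt (fun s : ℝ => 4 * B ^ 2 * (B + s) ^ 2)
      (4 * B ^ 2 * (2 * (B + s))) s := by
    have := ((((hasDerivAt_id s).const_add B).pow 2).const_mul (4 * B ^ 2))
    simpa using this
  refine (h1.div h2 (by positivity)).congr_deriv ?_
  field_simp
  ring

/-- The closed form is `s K(s) = (B⁻² - (B + s)⁻²) / 4`: the constant of integration makes this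
vanish at `s = 0`, so `K` is regular there, and its limit `1 / (4B²)` at infinity is the constant in
the final flux. -/
theorem fluxProfile_identity {B s : ℝ} (hB : 0 < B) (hs : 0 ≤ s) :
    2 * s * (-(3 * B + s) / (4 * B ^ 2 * (B + s) ^ 3)) + 2 * fluxProfile B s
      = ((B + s) ^ 3)⁻¹ := by
  have hBs : B + s ≠ 0 := by positivity
  unfold fluxProfile
  field_simp
  ring

/-- Green's theorem on a rectangle for the pullback under `(u, v)` of the radial density
`(B + |w|²)⁻³` of the plane. -/
theorem integral_radialDensity_rectangle {u v : ℝ × ℝ → ℝ} (hu : ContDiff ℝ 2 u)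
    (hv : ContDiff ℝ 2 v) {B : ℝ} (hB : 0 < B) (a b c d : ℝ) :
    (∫ x in a..b, ∫ y in c..d, ((B + (u (x, y) ^ 2 + v (x, y) ^ 2)) ^ 3)⁻¹ *
      (fderiv ℝ u (x, y) (1, 0) * fderiv ℝ v (x, y) (0, 1) -
        fderiv ℝ u (x, y) (0, 1) * fderiv ℝ v (x, y) (1, 0))) =
    (((∫ x in a..b, -(fluxProfile B (u (x, d) ^ 2 + v (x, d) ^ 2) *
        (u (x, d) * fderiv ℝ v (x, d) (1, 0) - v (x, d) * fderiv ℝ u (x, d) (1, 0)))) -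
      ∫ x in a..b, -(fluxProfile B (u (x, c) ^ 2 + v (x, c) ^ 2) *
        (u (x, c) * fderiv ℝ v (x, c) (1, 0) - v (x, c) * fderiv ℝ u (x, c) (1, 0)))) +
      ∫ y in c..d, fluxProfile B (u (b, y) ^ 2 + v (b, y) ^ 2) *
        (u (b, y) * fderiv ℝ v (b, y) (0, 1) - v (b, y) * fderiv ℝ u (b, y) (0, 1))) -
      ∫ y in c..d, fluxProfile B (u (a, y) ^ 2 + v (a, y) ^ 2) *
        (u (a, y) * fderiv ℝ v (a, y) (0, 1) - v (a, y) * fderiv ℝ u (a, y) (0, 1)) := by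
  have hu' : ContDiff ℝ 1 (fderiv ℝ u) := hu.fderiv_right (by norm_num)
  have hv' : ContDiff ℝ 1 (fderiv ℝ v) := hv.fderiv_right (by norm_num)
  have hud (p) : HasFDerivAt u (fderiv ℝ u p) p :=
    (hu.differentiable (by norm_num) p).hasFDerivAt
  have hvd (p) : HasFDerivAt v (fderiv ℝ v p) p :=
    (hv.differentiable (by norm_num) p).hasFDerivAt
  have hud' (p e) : HasFDerivAt (fun p => fderiv ℝ u p e)
      ((fderiv ℝ (fderiv ℝ u) p).flip e) p := by
    have := ((hu'.differentiable (by norm_num) p).hasFDerivAt).clm_apply (hasFDerivAt_const e p)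
    simpa using this
  have hvd' (p e) : HasFDerivAt (fun p => fderiv ℝ v p e)
      ((fderiv ℝ (fderiv ℝ v) p).flip e) p := by
    have := ((hv'.differentiable (by norm_num) p).hasFDerivAt).clm_apply (hasFDerivAt_const e p)
    simpa using this
  have hus (p e f) : fderiv ℝ (fderiv ℝ u) p e f = fderiv ℝ (fderiv ℝ u) p f e :=
    (hu.contDiffAt.isSymmSndFDerivAt (by simp)) e f
  have hvs (p e f) : fderiv ℝ (fderiv ℝ v) p e f = fderiv ℝ (fderiv ℝ v) p f e :=
    (hv.contDiffAt.isSymmSndFDerivAt (by simp)) e f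
  set K' : ℝ → ℝ := fun s => -(3 * B + s) / (4 * B ^ 2 * (B + s) ^ 3) with hK'
  have hK (p) : HasFDerivAt (fun p => fluxProfile B (u p ^ 2 + v p ^ 2))
      (K' (u p ^ 2 + v p ^ 2) • ((2 * u p) • fderiv ℝ u p + (2 * v p) • fderiv ℝ v p)) p := by
    have h := (hasDerivAt_fluxProfile hB
      (add_nonneg (sq_nonneg (u p)) (sq_nonneg (v p)))).comp_hasFDerivAt p
        (((hud p).pow 2).add ((hvd p).pow 2))
    refine h.congr_fderiv ?_
    simp [hK']
  have hW (p e) := (hK p).mul (((hud p).mul (hvd' p e)).sub ((hvd p).mul (hud' p e)))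
  have key := integral2_divergence_prod_of_hasFDerivAt
    (fun p => fluxProfile B (u p ^ 2 + v p ^ 2) *
        (u p * fderiv ℝ v p (0, 1) - v p * fderiv ℝ u p (0, 1)))
    (fun p => -(fluxProfile B (u p ^ 2 + v p ^ 2) *
        (u p * fderiv ℝ v p (1, 0) - v p * fderiv ℝ u p (1, 0))))
    _ _ a c b d
    (fun p _ => (hW p (0, 1)).continuousAt.continuousWithinAt)
    (fun p _ => (hW p (1, 0)).neg.continuousAt.continuousWithinAt)
    (fun p _ => hW p (0, 1)) (fun p _ => (hW p (1, 0)).neg)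
  -- This is `d(K(s)(u dv - v du)) = (2 s K' + 2 K) du ∧ dv` with `s = u² + v²`; the mixed second
  -- derivatives cancel by symmetry.
  have hdiv (p : ℝ × ℝ) : ((B + (u p ^ 2 + v p ^ 2)) ^ 3)⁻¹ *
      (fderiv ℝ u p (1, 0) * fderiv ℝ v p (0, 1) -
        fderiv ℝ u p (0, 1) * fderiv ℝ v p (1, 0)) =
      (fluxProfile B (u p ^ 2 + v p ^ 2) •
        (u p • (fderiv ℝ (fderiv ℝ v) p).flip (0, 1) + fderiv ℝ v p (0, 1) • fderiv ℝ u p -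
          (v p • (fderiv ℝ (fderiv ℝ u) p).flip (0, 1) + fderiv ℝ u p (0, 1) • fderiv ℝ v p)) +
        (u p * fderiv ℝ v p (0, 1) - v p * fderiv ℝ u p (0, 1)) •
          K' (u p ^ 2 + v p ^ 2) • ((2 * u p) • fderiv ℝ u p + (2 * v p) • fderiv ℝ v p)) (1, 0) +
      (-(fluxProfile B (u p ^ 2 + v p ^ 2) •
        (u p • (fderiv ℝ (fderiv ℝ v) p).flip (1, 0) + fderiv ℝ v p (1, 0) • fderiv ℝ u p -
          (v p • (fderiv ℝ (fderiv ℝ u) p).flip (1, 0) + fderiv ℝ u p (1, 0) • fderiv ℝ v p)) +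
        (u p * fderiv ℝ v p (1, 0) - v p * fderiv ℝ u p (1, 0)) •
          K' (u p ^ 2 + v p ^ 2) • ((2 * u p) • fderiv ℝ u p + (2 * v p) • fderiv ℝ v p)))
            (0, 1) := by
    rw [← fluxProfile_identity hB (add_nonneg (sq_nonneg (u p)) (sq_nonneg (v p)))]
    simp only [add_apply, sub_apply, neg_apply, smul_apply,
      ContinuousLinearMap.flip_apply, smul_eq_mul]
    rw [hus p (0, 1) (1, 0), hvs p (0, 1) (1, 0)]
    simp only [hK']
    ring
  simp_rw [hdiv]
  refine key (Integrable.congr (f := fun p => ((B + (u p ^ 2 + v p ^ 2)) ^ 3)⁻¹ *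
      (fderiv ℝ u p (1, 0) * fderiv ℝ v p (0, 1) -
        fderiv ℝ u p (0, 1) * fderiv ℝ v p (1, 0))) ?_ (Eventually.of_forall hdiv))
  refine ContinuousOn.integrableOn_compact (isCompact_uIcc.prod isCompact_uIcc)
    (Continuous.continuousOn ?_)
  have := hu.continuous
  have := hv.continuous
  have := hu'.continuous
  have := hv'.continuous
  refine Continuous.mul (Continuous.inv₀ (by fun_prop) fun p => by positivity) (by fun_prop)

/-- The Jacobian determinant of a map of the plane, in complex notation. -/
noncomputable def planarJacobian (g : ℂ → ℂ) (z : ℂ) : ℝ :=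
  (fderiv ℝ g z 1).re * (fderiv ℝ g z I).im - (fderiv ℝ g z 1).im * (fderiv ℝ g z I).re

/-- The boundary term of the polar form of Green's theorem along the loop `γ`. -/
noncomputable def fluxIntegrand (B : ℝ) (γ : ℝ → ℂ) (t : ℝ) : ℝ :=
  fluxProfile B (normSq (γ t)) * ((γ t).re * (deriv γ t).im - (γ t).im * (deriv γ t).re)

theorem hasFDerivAt_polar (p : ℝ × ℝ) :
    HasFDerivAt (fun p : ℝ × ℝ => (p.1 : ℂ) * (Real.cos p.2 + Real.sin p.2 * I))
      ((ContinuousLinearMap.fst ℝ ℝ ℝ).smulRight ((Real.cos p.2 : ℂ) + Real.sin p.2 * I) +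
        (ContinuousLinearMap.snd ℝ ℝ ℝ).smulRight
          ((p.1 : ℂ) * (-(Real.sin p.2 : ℂ) + Real.cos p.2 * I))) p := by
  have h1 : HasFDerivAt (fun p : ℝ × ℝ => (p.1 : ℂ))
      (ofRealCLM.comp (ContinuousLinearMap.fst ℝ ℝ ℝ)) p :=
    ofRealCLM.hasFDerivAt.comp p hasFDerivAt_fst
  have h2 : HasDerivAt (fun t : ℝ => (Real.cos t : ℂ) + Real.sin t * I)
      (-(Real.sin p.2 : ℂ) + Real.cos p.2 * I) p.2 := by
    have hc := (Real.hasDerivAt_cos p.2).ofReal_comp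
    have hs := (Real.hasDerivAt_sin p.2).ofReal_comp
    simpa using! hc.add (hs.mul_const I)
  have h3 := h2.hasFDerivAt.comp p (hasFDerivAt_snd (𝕜 := ℝ) (E := ℝ) (F := ℝ))
  refine (h1.mul h3).congr_fderiv ?_
  ext <;> simp

/-- The rectangle formula applies to `g` in polar coordinates on `[0, R] × [-π, π]`. The edges at
angles `±π` cancel by periodicity, the edge `r = 0` contributes nothing because it is collapsed to a
point, and only the circle of radius `R` remains. -/
theorem integral_radialDensity_disc {g : ℂ → ℂ} (hg : ContDiff ℝ 2 g) {B : ℝ} (hB : 0 < B)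
    (R : ℝ) :
    (∫ r in (0 : ℝ)..R, ∫ t in (-Real.pi)..Real.pi,
      r * (((B + normSq (g (Complex.polarCoord.symm (r, t)))) ^ 3)⁻¹ *
        planarJacobian g (Complex.polarCoord.symm (r, t)))) =
    ∫ t in (-Real.pi)..Real.pi, fluxIntegrand B (fun t => g (circleMap 0 R t)) t := by
  set h : ℝ × ℝ → ℂ := fun p => g (Complex.polarCoord.symm p) with hh
  have hpol : ⇑Complex.polarCoord.symm =
      fun p : ℝ × ℝ => (p.1 : ℂ) * (Real.cos p.2 + Real.sin p.2 * I) := by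
    ext p; simp
  have hcirc (r t : ℝ) : circleMap 0 r t = Complex.polarCoord.symm (r, t) := by
    simp [circleMap, Complex.exp_mul_I]
  have hpolc : ContDiff ℝ 2 (fun p : ℝ × ℝ => (p.1 : ℂ) * (Real.cos p.2 + Real.sin p.2 * I)) := by
    have hof : ContDiff ℝ 2 (fun x : ℝ => (x : ℂ)) := ofRealCLM.contDiff
    exact (hof.comp contDiff_fst).mul ((hof.comp (Real.contDiff_cos.comp contDiff_snd)).add
      ((hof.comp (Real.contDiff_sin.comp contDiff_snd)).mul contDiff_const))
  have hhc : ContDiff ℝ 2 h := by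
    simp only [hh, hpol]
    exact hg.comp hpolc
  have hfd (p) : HasFDerivAt h (fderiv ℝ h p) p :=
    (hhc.differentiable (by norm_num) p).hasFDerivAt
  have hfd' (p e) : fderiv ℝ h p e = fderiv ℝ g (Complex.polarCoord.symm p)
      ((e.1 : ℂ) * (Real.cos p.2 + Real.sin p.2 * I) +
        e.2 * (p.1 * (-(Real.sin p.2 : ℂ) + Real.cos p.2 * I))) := by
    have := ((hg.differentiable (by norm_num) (Complex.polarCoord.symm p)).hasFDerivAt).comp p
      (hpol ▸ hasFDerivAt_polar p)
    rw [show h = g ∘ ⇑Complex.polarCoord.symm from rfl, this.fderiv]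
    change fderiv ℝ g _ (e.1 • _ + e.2 • _) = _
    simp only [real_smul]
  have hre (p e) : fderiv ℝ (fun p => (h p).re) p e = (fderiv ℝ h p e).re := by
    have : HasFDerivAt (fun p => (h p).re) (reCLM.comp (fderiv ℝ h p)) p :=
      reCLM.hasFDerivAt.comp p (hfd p)
    rw [this.fderiv]
    simp
  have him (p e) : fderiv ℝ (fun p => (h p).im) p e = (fderiv ℝ h p e).im := by
    have : HasFDerivAt (fun p => (h p).im) (imCLM.comp (fderiv ℝ h p)) p :=
      imCLM.hasFDerivAt.comp p (hfd p)
    rw [this.fderiv]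
    simp
  have key := integral_radialDensity_rectangle (reCLM.contDiff.comp hhc) (imCLM.contDiff.comp hhc)
    hB 0 R (-Real.pi) Real.pi
  simp only [Function.comp_def, reCLM_apply, imCLM_apply, hre, him] at key
  have hdt (r t : ℝ) : deriv (fun t => g (circleMap 0 r t)) t = fderiv ℝ h (r, t) (0, 1) := by
    have h1 : HasDerivAt (fun t : ℝ => ((r, t) : ℝ × ℝ)) (0, 1) t :=
      (hasDerivAt_const t r).prodMk (hasDerivAt_id t)
    have := (hfd (r, t)).comp_hasDerivAt t h1
    simp only [hcirc]
    exact this.deriv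
  have hns (p) : normSq (h p) = (h p).re ^ 2 + (h p).im ^ 2 := by rw [normSq_apply]; ring
  have hper (x : ℝ) : (Complex.polarCoord.symm (x, Real.pi) : ℂ) =
      Complex.polarCoord.symm (x, -Real.pi) := by simp
  have hper1 (x : ℝ) : h (x, Real.pi) = h (x, -Real.pi) := by simp only [hh, hper]
  have hper2 (x : ℝ) : fderiv ℝ h (x, Real.pi) (1, 0) = fderiv ℝ h (x, -Real.pi) (1, 0) := by
    rw [hfd', hfd', hper]; simp
  have h0 (y : ℝ) : fderiv ℝ h (0, y) (0, 1) = 0 := by rw [hfd']; simp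
  simp only [hper1, hper2, sub_self, zero_add, h0, zero_re, zero_im, mul_zero,
    intervalIntegral.integral_zero, sub_zero] at key
  have hlin (L : ℂ →L[ℝ] ℂ) (a b : ℝ) : L (a + b * I) = a * L 1 + b * L I := by
    have : ((a : ℂ) + b * I) = a • (1 : ℂ) + b • I := by simp
    rw [this, map_add, map_smul, map_smul]
    simp
  have hleft (r t : ℝ) : r * (((B + normSq (g (Complex.polarCoord.symm (r, t)))) ^ 3)⁻¹ *
        planarJacobian g (Complex.polarCoord.symm (r, t))) =
      ((B + ((h (r, t)).re ^ 2 + (h (r, t)).im ^ 2)) ^ 3)⁻¹ *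
        ((fderiv ℝ h (r, t) (1, 0)).re * (fderiv ℝ h (r, t) (0, 1)).im -
          (fderiv ℝ h (r, t) (0, 1)).re * (fderiv ℝ h (r, t) (1, 0)).im) := by
    rw [hfd', hfd', mul_left_comm, ← hns]
    congr 1
    have e1 : ((((1, 0) : ℝ × ℝ).1 : ℂ) * (Real.cos t + Real.sin t * I) +
        (((1, 0) : ℝ × ℝ).2 : ℂ) * (r * (-(Real.sin t : ℂ) + Real.cos t * I))) =
        (Real.cos t : ℝ) + (Real.sin t : ℝ) * I := by simp
    have e2 : ((((0, 1) : ℝ × ℝ).1 : ℂ) * (Real.cos t + Real.sin t * I) +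
        (((0, 1) : ℝ × ℝ).2 : ℂ) * (r * (-(Real.sin t : ℂ) + Real.cos t * I))) =
        ((-(r * Real.sin t) : ℝ) : ℂ) + ((r * Real.cos t : ℝ) : ℂ) * I := by
      push_cast; simp; ring
    dsimp only at e1 e2 ⊢
    rw [e1, e2, hlin, hlin, planarJacobian]
    simp only [add_re, add_im, re_ofReal_mul, im_ofReal_mul]
    linear_combination (- r * ((fderiv ℝ g (Complex.polarCoord.symm (r, t)) 1).re *
      (fderiv ℝ g (Complex.polarCoord.symm (r, t)) I).im -
      (fderiv ℝ g (Complex.polarCoord.symm (r, t)) 1).im *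
      (fderiv ℝ g (Complex.polarCoord.symm (r, t)) I).re)) * Real.sin_sq_add_cos_sq t
  simp only [hleft, fluxIntegrand, hdt]
  rw [key]
  refine intervalIntegral.integral_congr fun t _ => ?_
  simp only [hcirc, ← hns]
  rfl

/-- Integrability in polar coordinates makes the disc integrals converge to the integral over the
plane, so the limit of the boundary flux must be that integral. -/
theorem integral_radialDensity_plane {g : ℂ → ℂ} (hg : ContDiff ℝ 2 g) {B : ℝ} (hB : 0 < B)
    (hint : Integrable fun z => ((B + normSq (g z)) ^ 3)⁻¹ * planarJacobian g z) {L : ℝ}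
    (hL : Tendsto (fun R => ∫ t in (-Real.pi)..Real.pi,
      fluxIntegrand B (fun t => g (circleMap 0 R t)) t) atTop (𝓝 L)) :
    ∫ z, ((B + normSq (g z)) ^ 3)⁻¹ * planarJacobian g z = L := by
  set k : ℂ → ℝ := fun z => ((B + normSq (g z)) ^ 3)⁻¹ * planarJacobian g z with hk
  have hkc : Continuous k := by
    have h1 := hg.continuous
    have h2 := hg.continuous_fderiv (by norm_num)
    have h3 := continuous_normSq
    refine Continuous.mul (Continuous.inv₀ (by fun_prop) fun z => ?_) ?_
    · have := normSq_nonneg (g z)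
      positivity
    · unfold planarJacobian
      fun_prop
  have hpol : ⇑Complex.polarCoord.symm =
      fun p : ℝ × ℝ => (p.1 : ℂ) * (Real.cos p.2 + Real.sin p.2 * I) := by
    ext p; simp
  have hpi : Integrable (fun p : ℝ × ℝ => p.1 * k (Complex.polarCoord.symm p))
      ((volume.restrict (Ioi 0)).prod (volume.restrict (Ioo (-Real.pi) Real.pi))) := by
    refine ⟨(Continuous.aestronglyMeasurable (by rw [hpol]; fun_prop)), ?_⟩
    rw [hasFiniteIntegral_iff_enorm, Measure.prod_restrict, ← Measure.volume_eq_prod,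
      ← polarCoord_target]
    have h1 := hasFiniteIntegral_iff_enorm.1 hint.2
    rw [← Complex.lintegral_comp_polarCoord_symm] at h1
    refine lt_of_eq_of_lt (setLIntegral_congr_fun polarCoord.open_target.measurableSet
      fun p hp => ?_) h1
    have hp1 : 0 < p.1 := hp.1
    simp only [enorm_mul, smul_eq_mul, Real.enorm_of_nonneg hp1.le]
  rw [← Complex.integral_comp_polarCoord_symm, polarCoord_target]
  simp only [smul_eq_mul]
  rw [Measure.volume_eq_prod, ← Measure.prod_restrict, integral_prod _ hpi]
  refine tendsto_nhds_unique
    (intervalIntegral_tendsto_integral_Ioi 0 hpi.integral_prod_left tendsto_id) (hL.congr fun R => ?_)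
  rw [← integral_radialDensity_disc hg hB]
  refine intervalIntegral.integral_congr fun r _ => ?_
  simp only
  rw [intervalIntegral.integral_of_le (by linarith [Real.pi_pos]), integral_Ioc_eq_integral_Ioo]

/-! ### Winding numbers and limits of the flux -/

/-- The derivative of the argument along a loop in the punctured plane. -/
noncomputable def angularSpeed (γ : ℝ → ℂ) (t : ℝ) : ℝ :=
  ((γ t).re * (deriv γ t).im - (γ t).im * (deriv γ t).re) / normSq (γ t)

/-- Compactness of the interval makes `‖φ x₀ t‖ + 1` a dominating function for `x` near `x₀`.
Continuity is required only along `x = x₀`, since the quotients to which this is applied may be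
singular elsewhere. -/
theorem tendsto_intervalIntegral_of_continuousAt {X : Type*} [TopologicalSpace X]
    [FirstCountableTopology X] {φ : X → ℝ → ℝ} {x₀ : X} {a b : ℝ} (hm : ∀ x, Measurable (φ x))
    (hφ : ∀ t, ContinuousAt (fun p : X × ℝ => φ p.1 p.2) (x₀, t)) :
    Tendsto (fun x => ∫ t in a..b, φ x t) (𝓝 x₀) (𝓝 (∫ t in a..b, φ x₀ t)) := by
  have hc : Continuous (φ x₀) := continuous_iff_continuousAt.2 fun t =>
    (hφ t).comp (f := fun t => (x₀, t)) (by fun_prop)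
  have hev : ∀ᶠ x in 𝓝 x₀, ∀ t ∈ uIcc a b, ‖φ x t‖ ≤ ‖φ x₀ t‖ + 1 := by
    refine isCompact_uIcc.eventually_forall_of_forall_eventually fun t _ => ?_
    have h1 : Tendsto (fun p : X × ℝ => ‖φ p.1 p.2‖ - ‖φ x₀ p.2‖) (𝓝 (x₀, t)) (𝓝 0) := by
      have h2 : ContinuousAt (fun p : X × ℝ => φ x₀ p.2) (x₀, t) := by fun_prop
      have := ((hφ t).norm.sub h2.norm).tendsto
      simpa using! this
    filter_upwards [h1.eventually (gt_mem_nhds one_pos)] with p hp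
    linarith
  refine intervalIntegral.tendsto_integral_filter_of_dominated_convergence
    (fun t => ‖φ x₀ t‖ + 1) (Eventually.of_forall fun x => (hm x).aestronglyMeasurable) ?_
    (Continuous.intervalIntegrable (by fun_prop) _ _) (ae_of_all _ fun t _ => ?_)
  · filter_upwards [hev] with x hx
    exact ae_of_all _ fun t ht => hx t (uIoc_subset_uIcc ht)
  · exact (hφ t).tendsto.comp (f := fun x => (x, t))
      ((Continuous.tendsto (by fun_prop) x₀ : Tendsto (fun x => (x, t)) (𝓝 x₀) (𝓝 (x₀, t))))

/-- With `L` the primitive of `γ' / γ` one has `γ = γ 0 * exp L`, so `Im L` is a continuous change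
of argument with derivative `angularSpeed γ`. Periodicity of `γ` forces `exp (L (2π)) = 1`, which
gives the integer. -/
theorem exists_hasWindingNumber {γ : ℝ → ℂ} (hγ : ContDiff ℝ 1 γ) (h0 : ∀ t, γ t ≠ 0)
    (hper : Function.Periodic γ (2 * Real.pi)) :
    ∃ n : ℤ, (∫ t in (-Real.pi)..Real.pi, angularSpeed γ t) = 2 * Real.pi * n ∧
      HasWindingNumber (fun t => γ t / ‖γ t‖) n := by
  have hd (t) : HasDerivAt γ (deriv γ t) t := (hγ.differentiable (by norm_num) t).hasDerivAt
  have hdc : Continuous (deriv γ) := hγ.continuous_deriv le_rfl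
  have hc := hγ.continuous
  set q : ℝ → ℂ := fun t => deriv γ t / γ t with hq
  have hqc : Continuous q := hdc.div hc h0
  set L : ℝ → ℂ := fun t => ∫ s in (0 : ℝ)..t, q s with hL
  have hLd (t) : HasDerivAt L (q t) t :=
    intervalIntegral.integral_hasDerivAt_right (hqc.intervalIntegrable _ _)
      hqc.aestronglyMeasurable.stronglyMeasurableAtFilter hqc.continuousAt
  have hLc : Continuous L := continuous_iff_continuousAt.2 fun t => (hLd t).continuousAt
  have hconst (t) : γ t * cexp (-L t) = γ 0 := by
    have hd0 (t) : HasDerivAt (fun t => γ t * cexp (-L t)) 0 t := by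
      refine ((hd t).mul (hLd t).neg.cexp).congr_deriv ?_
      simp only [hq]
      field_simp [h0 t]
      ring
    have := is_const_of_deriv_eq_zero (fun t => (hd0 t).differentiableAt)
      (fun t => (hd0 t).deriv) t 0
    simpa [hL] using this
  have hγL (t) : γ t = γ 0 * cexp (L t) := by
    rw [← hconst t, mul_assoc, ← Complex.exp_add]; simp
  have hang (t) : angularSpeed γ t = (q t).im := by
    simp only [angularSpeed, hq, Complex.div_im]
    ring
  have hangper : Function.Periodic (angularSpeed γ) (2 * Real.pi) := by
    intro t
    have hdper : deriv γ (t + 2 * Real.pi) = deriv γ t := by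
      rw [← deriv_comp_add_const]
      congr 1
      exact funext hper
    simp only [angularSpeed, hper t, hdper]
  have hint : (∫ t in (-Real.pi)..Real.pi, angularSpeed γ t) = (L (2 * Real.pi)).im := by
    have h1 := hangper.intervalIntegral_add_eq (-Real.pi) 0
    rw [show -Real.pi + 2 * Real.pi = Real.pi by ring, zero_add] at h1
    rw [h1]
    simp only [hang]
    exact imCLM.intervalIntegral_comp_comm (hqc.intervalIntegrable _ _)
  have hexp : cexp (L (2 * Real.pi)) = 1 := by
    have h1 := hγL (2 * Real.pi)
    have h2 := hper 0
    rw [zero_add] at h2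
    rw [h2] at h1
    exact (mul_left_cancel₀ (h0 0) (by rw [mul_one]; exact h1)).symm
  obtain ⟨n, hn⟩ := Complex.exp_eq_one_iff.1 hexp
  have him : (L (2 * Real.pi)).im = 2 * Real.pi * n := by
    rw [hn]; simp; ring
  refine ⟨n, hint.trans him, fun t => arg (γ 0) + (L t).im, by fun_prop, fun t => ?_, ?_⟩
  · have hnorm : ‖γ t‖ = ‖γ 0‖ * Real.exp (L t).re := by
      rw [hγL t, norm_mul, Complex.norm_exp]
    have h3 : γ 0 = ‖γ 0‖ * cexp (arg (γ 0) * I) := (norm_mul_exp_arg_mul_I _).symm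
    have h4 : (‖γ 0‖ : ℂ) ≠ 0 := by simpa using h0 0
    change γ t / ‖γ t‖ = _
    have h5 : cexp (L t) = cexp (L t).re * cexp ((L t).im * I) := by
      rw [← Complex.exp_add, re_add_im]
    rw [hnorm, hγL t, h5]
    push_cast
    rw [add_mul, Complex.exp_add]
    nth_rewrite 1 [h3]
    field_simp
  · simp only [him]
    simp [hL]

theorem deriv_comp_circleMap {H : ℂ × ℂ → ℂ} (hH : ContDiff ℝ 2 H) (c : ℂ) (r : ℝ) (β : ℂ)
    (t : ℝ) : deriv (fun t => H (circleMap c r t, β)) t =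
      fderiv ℝ H (circleMap c r t, β) (circleMap 0 r t * I, 0) := by
  have h1 : HasDerivAt (fun t : ℝ => (circleMap c r t, β)) (circleMap 0 r t * I, 0) t :=
    (hasDerivAt_circleMap c r t).prodMk (hasDerivAt_const t β)
  exact ((hH.differentiable (by norm_num) _).hasFDerivAt.comp_hasDerivAt t h1).deriv

/-- The integrand `fluxIntegrand` along the loop `σ⁻¹ᐟ² γ`, extended to `σ = 0`. -/
noncomputable def scaledFlux (B σ : ℝ) (γ : ℝ → ℂ) (t : ℝ) : ℝ :=
  (2 * B * σ + normSq (γ t)) / (4 * B ^ 2 * (B * σ + normSq (γ t)) ^ 2) *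
    ((γ t).re * (deriv γ t).im - (γ t).im * (deriv γ t).re)

/-- This replaces the limit `N → ∞` by `σ = N⁻² → 0`, where the integrand extends continuously as
long as `γ` does not vanish. -/
theorem fluxIntegrand_smul {B N : ℝ} (hN : 0 < N) (γ : ℝ → ℂ) (t : ℝ) :
    fluxIntegrand B (fun t => N * γ t) t = scaledFlux B (N ^ 2)⁻¹ γ t := by
  simp only [fluxIntegrand, scaledFlux, fluxProfile, deriv_const_mul_field', re_ofReal_mul,
    im_ofReal_mul, normSq_mul, normSq_ofReal]
  -- When a denominator vanishes, both sides are zero by the convention on division.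
  by_cases h : B + N ^ 2 * normSq (γ t) = 0
  · have h' : B * (N ^ 2)⁻¹ + normSq (γ t) = 0 := by
      field_simp; linarith
    rw [← pow_two, h, h']; simp
  by_cases hB : B = 0
  · simp [hB]
  have h' : B * (N ^ 2)⁻¹ + normSq (γ t) ≠ 0 := by
    intro h2; apply h; field_simp at h2; linarith
  rw [← pow_two, show B * (N ^ 2)⁻¹ + normSq (γ t) = (B + N ^ 2 * normSq (γ t)) / N ^ 2 by
    field_simp]
  field_simp

theorem scaledFlux_zero {B : ℝ} {γ : ℝ → ℂ} {t : ℝ} :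
    scaledFlux B 0 γ t = (4 * B ^ 2)⁻¹ * angularSpeed γ t := by
  simp only [scaledFlux, angularSpeed, mul_zero, zero_add]
  by_cases h : normSq (γ t) = 0
  · simp [h]
  by_cases hB : B = 0
  · simp [hB]
  field_simp

/-- Letting scale, radius and second coordinate vary together serves two purposes: the limit over
large circles in a fibre, and the continuity of the winding integral in the radius. -/
theorem tendsto_integral_scaledFlux {H : ℂ × ℂ → ℂ} (hH : ContDiff ℝ 2 H) {c : ℂ} {r₀ : ℝ}
    (h0 : ∀ t, H (circleMap c r₀ t, 0) ≠ 0) {B : ℝ} (hB : B ≠ 0) :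
    Tendsto (fun q : ℝ × ℝ × ℂ => ∫ t in (-Real.pi)..Real.pi,
        scaledFlux B q.1 (fun t => H (circleMap c q.2.1 t, q.2.2)) t) (𝓝 (0, r₀, 0))
      (𝓝 ((4 * B ^ 2)⁻¹ * ∫ t in (-Real.pi)..Real.pi,
        angularSpeed (fun t => H (circleMap c r₀ t, 0)) t)) := by
  have hHc := hH.continuous
  have hHd := hH.continuous_fderiv (by norm_num)
  have hns := continuous_normSq
  have hcm (c : ℂ) : Continuous fun p : ℝ × ℝ => circleMap c p.1 p.2 := by
    unfold circleMap; fun_prop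
  have hγ : Continuous fun p : (ℝ × ℝ × ℂ) × ℝ => H (circleMap c p.1.2.1 p.2, p.1.2.2) :=
    hHc.comp (((hcm c).comp (by fun_prop :
      Continuous fun p : (ℝ × ℝ × ℂ) × ℝ => (p.1.2.1, p.2))).prodMk (by fun_prop))
  have hγ' : Continuous fun p : (ℝ × ℝ × ℂ) × ℝ =>
      deriv (fun t => H (circleMap c p.1.2.1 t, p.1.2.2)) p.2 := by
    simp only [deriv_comp_circleMap hH]
    have h1 (c) := (hcm c).comp (by fun_prop :
      Continuous fun p : (ℝ × ℝ × ℂ) × ℝ => (p.1.2.1, p.2))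
    exact (hHd.comp ((h1 c).prodMk (by fun_prop))).clm_apply
      (((h1 0).mul continuous_const).prodMk continuous_const)
  have key := tendsto_intervalIntegral_of_continuousAt (a := -Real.pi) (b := Real.pi)
    (x₀ := ((0 : ℝ), r₀, (0 : ℂ))) (φ := fun (q : ℝ × ℝ × ℂ) (t : ℝ) =>
      scaledFlux B q.1 (fun t => H (circleMap c q.2.1 t, q.2.2)) t) ?_ ?_
  · simpa only [scaledFlux_zero, intervalIntegral.integral_const_mul] using key
  · intro x
    have h1 : Continuous fun t => H (circleMap c x.2.1 t, x.2.2) :=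
      hγ.comp (by fun_prop : Continuous fun t : ℝ => (x, t))
    have h2 : Continuous fun t => deriv (fun t => H (circleMap c x.2.1 t, x.2.2)) t :=
      hγ'.comp (by fun_prop : Continuous fun t : ℝ => (x, t))
    unfold scaledFlux
    refine Measurable.mul (Measurable.div ?_ ?_) ?_ <;>
    · refine Continuous.measurable ?_
      fun_prop
  · intro t
    unfold scaledFlux
    refine ContinuousAt.mul (ContinuousAt.div (by fun_prop) (by fun_prop) ?_) (by fun_prop)
    have := normSq_pos.2 (h0 t)
    simp only [mul_zero, zero_add]
    positivity

/-- The winding integral divided by `2π` is continuous in the radius and integer valued, hence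
constant on a connected set of radii. -/
theorem exists_forall_winding {f : ℂ → ℂ} (hf : ContDiff ℝ 2 f) {c : ℂ} {S : Set ℝ}
    (hS : IsPreconnected S) (h0 : ∀ r ∈ S, ∀ t, f (circleMap c r t) ≠ 0) :
    ∃ n : ℤ, ∀ r ∈ S,
      (∫ t in (-Real.pi)..Real.pi, angularSpeed (fun t => f (circleMap c r t)) t) =
        2 * Real.pi * n ∧
      HasWindingNumber (fun t => f (circleMap c r t) / ‖f (circleMap c r t)‖) n := by
  have hcm (r : ℝ) : ContDiff ℝ 1 (fun t => f (circleMap c r t)) :=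
    (hf.of_le (by norm_num)).comp (contDiff_circleMap c r)
  have hex (r : ℝ) : ∃ n : ℤ, r ∈ S →
      (∫ t in (-Real.pi)..Real.pi, angularSpeed (fun t => f (circleMap c r t)) t) =
        2 * Real.pi * n ∧
      HasWindingNumber (fun t => f (circleMap c r t) / ‖f (circleMap c r t)‖) n := by
    by_cases hr : r ∈ S
    · obtain ⟨n, hn⟩ := exists_hasWindingNumber (hcm r) (h0 r hr)
        (fun t => by simp only [periodic_circleMap c r t])
      exact ⟨n, fun _ => hn⟩
    · exact ⟨0, fun h => absurd h hr⟩
  choose n hn using hex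
  have hcont : ContinuousOn n S := by
    rw [Int.isClosedEmbedding_coe_real.isInducing.continuousOn_iff]
    intro r hr
    have h1 := tendsto_integral_scaledFlux (H := fun p => f p.1) (hf.comp contDiff_fst) (h0 r hr)
      (one_ne_zero (α := ℝ))
    have h2 := h1.comp (f := fun r : ℝ => ((0 : ℝ), r, (0 : ℂ)))
      (Continuous.tendsto (by fun_prop) r)
    simp only [Function.comp_def, scaledFlux_zero, intervalIntegral.integral_const_mul] at h2
    -- With `B = 1` and `σ = 0` the flux is a quarter of the winding integral; the factor `4 / (2π)`
    -- recovers the integer.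
    have h3 := (h2.mono_left (nhdsWithin_le_nhds (s := S))).const_mul (4 / (2 * Real.pi))
    refine Tendsto.congr' ?_ (h3.trans (le_of_eq ?_))
    · filter_upwards [self_mem_nhdsWithin] with x hx
      rw [(hn x hx).1]
      have := Real.pi_ne_zero
      simp; field_simp
    · rw [(hn r hr).1]
      have := Real.pi_ne_zero
      congr 1
      simp; field_simp
  rcases S.eq_empty_or_nonempty with rfl | ⟨r₀, hr₀⟩
  · exact ⟨0, by simp⟩
  · exact ⟨n r₀, fun r hr => hS.constant hcont hr hr₀ ▸ hn r hr⟩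

/-! ### The homogeneous extension of a map of the sphere -/

/-- The extension of a map of the unit sphere, homogeneous of degree one. -/
noncomputable def radialExtension {m : ℕ}
    (Φ : EuclideanSpace ℝ (Fin m) → EuclideanSpace ℝ (Fin m)) (x : EuclideanSpace ℝ (Fin m)) :
    EuclideanSpace ℝ (Fin m) :=
  ‖x‖ • Φ (‖x‖⁻¹ • x)

section Radial

variable {m : ℕ} {Φ : EuclideanSpace ℝ (Fin m) → EuclideanSpace ℝ (Fin m)}

theorem hasFDerivAt_norm_of_norm_eq_one {E : Type*} [NormedAddCommGroup E]
    [InnerProductSpace ℝ E] {u : E} (hu : ‖u‖ = 1) : HasFDerivAt (‖·‖) (innerSL ℝ u) u := by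
  have h1 := (hasStrictFDerivAt_norm_sq u).hasFDerivAt.sqrt (by rw [hu]; norm_num)
  simp only [Real.sqrt_sq (norm_nonneg _), hu] at h1
  refine h1.congr_fderiv ?_
  ext v
  simp

theorem fderiv_apply_self_eq_zero {E F : Type*} [NormedAddCommGroup E] [NormedSpace ℝ E]
    [NormedAddCommGroup F] [NormedSpace ℝ F] {f : E → F} {u : E} (hf : DifferentiableAt ℝ f u)
    (hom : ∀ r : ℝ, 0 < r → f (r • u) = f u) : fderiv ℝ f u u = 0 := by
  have h1 : HasDerivAt (fun r : ℝ => r • u) u 1 := by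
    simpa using (hasDerivAt_id (1 : ℝ)).smul_const u
  have h2 : HasFDerivAt f (fderiv ℝ f u) ((1 : ℝ) • u) := by
    rw [one_smul]; exact hf.hasFDerivAt
  have h3 := h2.comp_hasDerivAt (1 : ℝ) h1
  have h4 : HasDerivAt (f ∘ fun r : ℝ => r • u) 0 1 := by
    refine (hasDerivAt_const (1 : ℝ) (f u)).congr_of_eventuallyEq ?_
    filter_upwards [lt_mem_nhds one_pos] with r hr using hom r hr
  exact h3.unique h4

theorem normalize_smul {E : Type*} [NormedAddCommGroup E] [NormedSpace ℝ E] (u : E) {r : ℝ}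
    (hr : 0 < r) : ‖r • u‖⁻¹ • r • u = ‖u‖⁻¹ • u := by
  rw [norm_smul, Real.norm_of_nonneg hr.le, mul_inv, smul_smul]
  congr 1
  field_simp

theorem contDiffAt_normalize {E : Type*} [NormedAddCommGroup E]
    [InnerProductSpace ℝ E] {u : E} (hu : u ≠ 0) {n : WithTop ℕ∞} :
    ContDiffAt ℝ n (fun v : E => ‖v‖⁻¹ • v) u :=
  ((contDiffAt_norm ℝ hu).inv (norm_ne_zero_iff.2 hu)).smul contDiffAt_id

/-- Near `u` the extension is `‖v‖ N(v) q(v)`, where the norm `N` and the direction `q` of `Φ` are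
homogeneous of degree zero, so that `N' u = 0` and `q' u = 0`. Its derivative is `N • (q' + ⟪u, ·⟫
q)` composed with `id + N⁻¹ N' ⊗ u`. The first map without its factor `N` defines `sphereJacobian`;
the second is a transvection of determinant one. -/
theorem det_fderiv_radialExtension {u : EuclideanSpace ℝ (Fin m)} (hu : ‖u‖ = 1)
    (hΦ : DifferentiableAt ℝ Φ u) (h0 : Φ u ≠ 0) :
    (fderiv ℝ (radialExtension Φ) u).det =
      ‖Φ u‖ ^ m * sphereJacobian (fun x => ‖Φ x‖⁻¹ • Φ x) u := by
  have hune : u ≠ 0 := by rintro rfl; simp at hu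
  have hQu : ‖u‖⁻¹ • u = u := by simp [hu]
  set Q : EuclideanSpace ℝ (Fin m) → EuclideanSpace ℝ (Fin m) := fun v => ‖v‖⁻¹ • v with hQ
  have hQd : DifferentiableAt ℝ Q u :=
    (contDiffAt_normalize hune (n := 1)).differentiableAt (by norm_num)
  have hcd : DifferentiableAt ℝ (fun v => Φ (Q v)) u :=
    DifferentiableAt.comp u (f := Q) (g := Φ) (by rw [hQ]; simpa only [hQu] using hΦ) hQd
  have hΦQ : Φ (Q u) = Φ u := by rw [hQ]; simp only [hQu]
  have h0' : Φ (Q u) ≠ 0 := hΦQ ▸ h0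
  have hNd : DifferentiableAt ℝ (fun v => ‖Φ (Q v)‖) u := hcd.norm ℝ h0'
  have hqd : DifferentiableAt ℝ (fun v => ‖Φ (Q v)‖⁻¹ • Φ (Q v)) u :=
    (hNd.inv (norm_ne_zero_iff.2 h0')).smul hcd
  have hhom (r : ℝ) (hr : 0 < r) : Q (r • u) = Q u := normalize_smul u hr
  set N' := fderiv ℝ (fun v => ‖Φ (Q v)‖) u with hN'
  set q' := fderiv ℝ (fun v => ‖Φ (Q v)‖⁻¹ • Φ (Q v)) u with hq'
  set N := ‖Φ u‖ with hN
  have hNpos : 0 < N := norm_pos_iff.2 h0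
  set q := N⁻¹ • Φ u with hq
  have hN'u : N' u = 0 := fderiv_apply_self_eq_zero hNd fun r hr => by simp only [hhom r hr]
  have hq'u : q' u = 0 := fderiv_apply_self_eq_zero hqd fun r hr => by simp only [hhom r hr]
  have hΨ : HasFDerivAt (radialExtension Φ)
      (N • q' + N'.smulRight q + (innerSL ℝ u).smulRight (N • q)) u := by
    have h1 := (hasFDerivAt_norm_of_norm_eq_one hu).smul
      (HasFDerivAt.smul (c := fun v => ‖Φ (Q v)‖) (f := fun v => ‖Φ (Q v)‖⁻¹ • Φ (Q v))
        hNd.hasFDerivAt hqd.hasFDerivAt)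
    refine (h1.congr_of_eventuallyEq ?_).congr_fderiv ?_
    · have hev : ∀ᶠ v in 𝓝 u, Φ (Q v) ≠ 0 := hcd.continuousAt.eventually_ne h0'
      filter_upwards [hev] with v hv
      simp only [radialExtension, Pi.smul_apply', hQ] at hv ⊢
      rw [smul_smul ‖Φ _‖, mul_inv_cancel₀ (norm_ne_zero_iff.2 hv), one_smul]
    · simp only [Pi.smul_apply', hΦQ, hu, one_smul]
      rfl
  have hA : N • q' + N'.smulRight q + (innerSL ℝ u).smulRight (N • q) =
      N • ((q' + (innerSL ℝ u).smulRight q).comp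
        (ContinuousLinearMap.id ℝ _ + (N⁻¹ • N').smulRight u)) := by
    ext1 v
    simp [hq'u, hu, smul_smul, hNpos.ne', smul_add]
    module
  rw [hΨ.fderiv, hA]
  have hsj : sphereJacobian (fun x => ‖Φ x‖⁻¹ • Φ x) u =
      (q' + (innerSL ℝ u).smulRight q).det := rfl
  rw [hsj]
  have htv : ((ContinuousLinearMap.id ℝ (EuclideanSpace ℝ (Fin m)) + (N⁻¹ • N').smulRight u :
      EuclideanSpace ℝ (Fin m) →L[ℝ] EuclideanSpace ℝ (Fin m)) :
      EuclideanSpace ℝ (Fin m) →ₗ[ℝ] EuclideanSpace ℝ (Fin m)) =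
      LinearMap.transvection ((N⁻¹ • N' : _ →L[ℝ] ℝ) : _ →ₗ[ℝ] ℝ) u := by
    ext1 v; rfl
  simp only [ContinuousLinearMap.det, ContinuousLinearMap.toLinearMap_smul,
    ContinuousLinearMap.toLinearMap_comp, LinearMap.det_smul, LinearMap.det_comp, htv]
  rw [LinearMap.transvection.det]
  simp [hN'u]

theorem radialExtension_smul (x : EuclideanSpace ℝ (Fin m)) {r : ℝ} (hr : 0 < r) :
    radialExtension Φ (r • x) = r • radialExtension Φ x := by
  rw [radialExtension, normalize_smul x hr, norm_smul, Real.norm_of_nonneg hr.le, radialExtension,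
    smul_smul]

theorem fderiv_radialExtension_smul (x : EuclideanSpace ℝ (Fin m)) {r : ℝ} (hr : 0 < r) :
    fderiv ℝ (radialExtension Φ) (r • x) = fderiv ℝ (radialExtension Φ) x := by
  have h1 : (fun v => radialExtension Φ (r • v)) = fun v => r • radialExtension Φ v :=
    funext fun v => radialExtension_smul v hr
  have h2 : fderiv ℝ (fun v => radialExtension Φ (r • v)) x =
      r • fderiv ℝ (radialExtension Φ) (r • x) := fderiv_comp_smul r
  rw [h1] at h2
  have h3 : fderiv ℝ (fun v => r • radialExtension Φ v) x =
      r • fderiv ℝ (radialExtension Φ) x :=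
    congrFun (fderiv_const_smul_field (𝕜 := ℝ) (f := radialExtension Φ) r) x
  rw [h3] at h2
  exact (smul_right_injective _ hr.ne' h2).symm

theorem contDiffOn_radialExtension {n : WithTop ℕ∞} (hΦ : ContDiff ℝ n Φ) :
    ContDiffOn ℝ n (radialExtension Φ) {0}ᶜ := fun x hx =>
  ((contDiffAt_norm ℝ hx).smul (hΦ.contDiffAt.comp x (contDiffAt_normalize hx))).contDiffWithinAt

theorem radialExtension_of_norm_eq_one {x : EuclideanSpace ℝ (Fin m)} (hx : ‖x‖ = 1) :
    radialExtension Φ x = Φ x := by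
  simp [radialExtension, hx]

end Radial

/-! ### The mapping degree as an integral over `ℝ⁴` -/

theorem integral_eq_integral_sphere_radial {E : Type*} [NormedAddCommGroup E]
    [NormedSpace ℝ E] [MeasurableSpace E] [BorelSpace E] [FiniteDimensional ℝ E] [Nontrivial E]
    (μ : Measure E) [μ.IsAddHaarMeasure] {f : E → ℝ} (hf : Integrable f μ) :
    ∫ x, f x ∂μ = ∫ s, ∫ r in Ioi (0 : ℝ), r ^ (Module.finrank ℝ E - 1) * f (r • (s : E))
      ∂volume ∂μ.toSphere := by
  set n := Module.finrank ℝ E - 1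
  set w : Metric.sphere (0 : E) 1 × Ioi (0 : ℝ) → ℝ := fun p => f (p.2.1 • p.1.1) with hw
  have hmp := μ.measurePreserving_homeomorphUnitSphereProd
  have hemb := Homeomorph.measurableEmbedding (homeomorphUnitSphereProd E)
  have hwc (x : ({0}ᶜ : Set E)) : w (homeomorphUnitSphereProd E x) = f x := by
    simp only [hw]
    congr 1
    have := (homeomorphUnitSphereProd E).symm_apply_apply x
    exact congrArg Subtype.val this
  have hwint : Integrable w (μ.toSphere.prod (Measure.volumeIoiPow n)) := by
    rw [← hmp.integrable_comp_emb hemb]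
    refine Integrable.congr (f := f ∘ Subtype.val) ?_ (ae_of_all _ fun x => (hwc x).symm)
    rw [← integrableOn_iff_comap_subtypeVal (by measurability)]
    exact hf.integrableOn
  calc ∫ x, f x ∂μ = ∫ x : ({0}ᶜ : Set E), f x ∂(μ.comap (↑)) := by
        rw [integral_subtype_comap (measurableSet_singleton _).compl f, restrict_compl_singleton]
    _ = ∫ p, w p ∂(μ.toSphere.prod (Measure.volumeIoiPow n)) := by
        rw [← hmp.integral_comp hemb]
        simp only [hwc]
    _ = _ := by
        rw [integral_prod _ hwint]
        refine integral_congr_ae (ae_of_all _ fun s => ?_)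
        simp only [Measure.volumeIoiPow, ENNReal.ofReal, hw]
        rw [integral_withDensity_eq_integral_smul,
          integral_subtype_comap measurableSet_Ioi
            fun a ↦ Real.toNNReal (a ^ n) • f (a • (s : E)),
          setIntegral_congr_fun measurableSet_Ioi fun x hx ↦ ?_]
        · rw [NNReal.smul_def, Real.coe_toNNReal _ (pow_nonneg hx.out.le _), smul_eq_mul]
        · exact (measurable_subtype_coe.pow_const _).real_toNNReal

section Density

variable {Φ : EuclideanSpace ℝ (Fin 4) → EuclideanSpace ℝ (Fin 4)}

theorem integrable_inv_one_add_norm_sq_pow :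
    Integrable fun x : EuclideanSpace ℝ (Fin 4) => ((1 + ‖x‖ ^ 2) ^ 3)⁻¹ := by
  have h := integrable_rpow_neg_one_add_norm_sq (E := EuclideanSpace ℝ (Fin 4)) (μ := volume)
    (r := 6) (by simp; norm_num)
  refine h.congr (ae_of_all _ fun x => ?_)
  have : (0 : ℝ) < 1 + ‖x‖ ^ 2 := by positivity
  simp only
  rw [show (-6 / 2 : ℝ) = -((3 : ℕ) : ℝ) by norm_num, Real.rpow_neg this.le, Real.rpow_natCast]

theorem exists_pos_le_norm_radialExtension (hΦ : Continuous Φ) (h0 : ∀ x, ‖x‖ = 1 → Φ x ≠ 0) :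
    ∃ c > 0, c ≤ 1 ∧ ∀ x, c * ‖x‖ ≤ ‖radialExtension Φ x‖ := by
  obtain ⟨u, hu, hmin⟩ := (isCompact_sphere (0 : EuclideanSpace ℝ (Fin 4)) 1).exists_isMinOn
    (NormedSpace.sphere_nonempty.2 zero_le_one) hΦ.norm.continuousOn
  have hu1 : ‖u‖ = 1 := by simpa using hu
  have hpos : 0 < ‖Φ u‖ := norm_pos_iff.2 (h0 u hu1)
  -- The cap at `1` yields `c² (1 + ‖x‖²) ≤ 1 + ‖radialExtension Φ x‖²` in the integrability proof.
  refine ⟨min ‖Φ u‖ 1, lt_min hpos one_pos, min_le_right _ _, fun x => ?_⟩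
  rcases eq_or_ne x 0 with rfl | hx
  · simp
  have hx' : ‖x‖ ≠ 0 := norm_ne_zero_iff.2 hx
  have h1 : ‖‖x‖⁻¹ • x‖ = 1 := by
    rw [norm_smul, norm_inv, norm_norm, inv_mul_cancel₀ hx']
  have h2 : ‖Φ u‖ ≤ ‖Φ (‖x‖⁻¹ • x)‖ := hmin (by simpa using h1)
  rw [radialExtension, norm_smul, norm_norm, mul_comm]
  gcongr
  exact (min_le_left _ _).trans h2

theorem exists_abs_det_fderiv_radialExtension_le (hΦ : ContDiff ℝ 1 Φ) :
    ∃ C, ∀ x ≠ 0, |(fderiv ℝ (radialExtension Φ) x).det| ≤ C := by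
  have hc : ContinuousOn (fun x => (fderiv ℝ (radialExtension Φ) x).det) {0}ᶜ :=
    ContinuousLinearMap.continuous_det.comp_continuousOn
      ((contDiffOn_radialExtension hΦ).continuousOn_fderiv_of_isOpen
        isOpen_compl_singleton le_rfl)
  obtain ⟨C, hC⟩ := (isCompact_sphere (0 : EuclideanSpace ℝ (Fin 4)) 1).exists_bound_of_continuousOn
    (hc.mono fun x hx => by rintro rfl; simp at hx)
  refine ⟨C, fun x hx => ?_⟩
  have hx' : ‖x‖ ≠ 0 := norm_ne_zero_iff.2 hx
  have h1 : ‖‖x‖⁻¹ • x‖ = 1 := by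
    rw [norm_smul, norm_inv, norm_norm, inv_mul_cancel₀ hx']
  rw [← fderiv_radialExtension_smul x (inv_pos.2 (norm_pos_iff.2 hx))]
  exact hC _ (by simpa using h1)

/-- The determinant is homogeneous of degree zero, hence bounded, and the density decays like
`‖x‖⁻⁶`, which is integrable in dimension four. -/
theorem integrable_density_radialExtension (hΦ : ContDiff ℝ 1 Φ)
    (h0 : ∀ x, ‖x‖ = 1 → Φ x ≠ 0) :
    Integrable fun x => ((1 + ‖radialExtension Φ x‖ ^ 2) ^ 3)⁻¹ *
      (fderiv ℝ (radialExtension Φ) x).det := by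
  obtain ⟨c, hc, hc1, hcle⟩ := exists_pos_le_norm_radialExtension hΦ.continuous h0
  obtain ⟨C, hC⟩ := exists_abs_det_fderiv_radialExtension_le hΦ
  have hm1 : Measurable (radialExtension Φ) := by
    have := hΦ.continuous.measurable
    unfold radialExtension
    fun_prop
  have hm2 : Measurable fun x => (fderiv ℝ (radialExtension Φ) x).det :=
    ContinuousLinearMap.continuous_det.measurable.comp (measurable_fderiv ℝ _)
  refine (integrable_inv_one_add_norm_sq_pow.mul_const ((c ^ 6)⁻¹ * C)).mono'
    (by fun_prop) ?_
  have hne : ∀ᵐ x : EuclideanSpace ℝ (Fin 4), x ≠ 0 := Measure.ae_ne volume 0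
  filter_upwards [hne] with x hx
  rw [norm_mul, Real.norm_of_nonneg (by positivity), Real.norm_eq_abs, ← mul_assoc]
  have h1 : c ^ 2 * (1 + ‖x‖ ^ 2) ≤ 1 + ‖radialExtension Φ x‖ ^ 2 := by
    have h2 : (c * ‖x‖) ^ 2 ≤ ‖radialExtension Φ x‖ ^ 2 := by gcongr; exact hcle x
    have h3 : c ^ 2 ≤ 1 := pow_le_one₀ hc.le hc1
    nlinarith
  refine mul_le_mul ?_ (hC x hx) (abs_nonneg _) (by positivity)
  rw [← mul_inv]
  refine inv_anti₀ (by positivity) ?_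
  calc (1 + ‖x‖ ^ 2) ^ 3 * c ^ 6 = (c ^ 2 * (1 + ‖x‖ ^ 2)) ^ 3 := by ring
    _ ≤ _ := by gcongr

/-- The mapping degree as the integral over `ℝ⁴` of a pulled back radial density. -/
theorem integral_density_radialExtension (hΦ : ContDiff ℝ 1 Φ)
    (h0 : ∀ x, ‖x‖ = 1 → Φ x ≠ 0) :
    ∫ x, ((1 + ‖radialExtension Φ x‖ ^ 2) ^ 3)⁻¹ * (fderiv ℝ (radialExtension Φ) x).det =
      mappingDegree (fun x => ‖Φ x‖⁻¹ • Φ x) *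
        ∫ x : EuclideanSpace ℝ (Fin 4), ((1 + ‖x‖ ^ 2) ^ 3)⁻¹ := by
  rw [integral_eq_integral_sphere_radial volume (integrable_density_radialExtension hΦ h0),
    integral_eq_integral_sphere_radial volume integrable_inv_one_add_norm_sq_pow]
  simp only [finrank_euclideanSpace_fin, Nat.add_one_sub_one]
  set J : ℝ := ∫ r in Ioi (0 : ℝ), r ^ 3 * ((1 + r ^ 2) ^ 3)⁻¹ with hJ
  have hs (s : Metric.sphere (0 : EuclideanSpace ℝ (Fin 4)) 1) :
      ‖(s : EuclideanSpace ℝ (Fin 4))‖ = 1 := by simp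
  have h1 (s : Metric.sphere (0 : EuclideanSpace ℝ (Fin 4)) 1) :
      ∫ r in Ioi (0 : ℝ), r ^ 3 * ((1 + ‖r • (s : EuclideanSpace ℝ (Fin 4))‖ ^ 2) ^ 3)⁻¹ = J := by
    refine setIntegral_congr_fun measurableSet_Ioi fun r hr => ?_
    have hr : 0 < r := hr
    simp only [norm_smul, hs, mul_one, Real.norm_of_nonneg hr.le]
  have h2 (s : Metric.sphere (0 : EuclideanSpace ℝ (Fin 4)) 1) :
      ∫ r in Ioi (0 : ℝ), r ^ 3 *
        (((1 + ‖radialExtension Φ (r • (s : EuclideanSpace ℝ (Fin 4)))‖ ^ 2) ^ 3)⁻¹ *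
          (fderiv ℝ (radialExtension Φ) (r • (s : EuclideanSpace ℝ (Fin 4)))).det) =
      sphereJacobian (fun x => ‖Φ x‖⁻¹ • Φ x) s * J := by
    set N := ‖Φ s‖ with hN
    have hNpos : 0 < N := norm_pos_iff.2 (h0 s (hs s))
    -- On the ray through `s` the extension stretches by `N`. The substitution `r ↦ N r` absorbs the
    -- factor `N ^ 4` of the determinant, so only the Jacobian on the sphere remains.
    have h3 := integral_comp_mul_left_Ioi (fun r : ℝ => r ^ 3 * ((1 + r ^ 2) ^ 3)⁻¹) 0 hNpos
    rw [mul_zero, smul_eq_mul, ← hJ] at h3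
    have h4 : J = N * (N⁻¹ * J) := by field_simp
    rw [h4, ← h3, ← integral_const_mul, ← integral_const_mul]
    refine setIntegral_congr_fun measurableSet_Ioi fun r hr => ?_
    have hr : 0 < r := hr
    simp only [radialExtension_smul _ hr, fderiv_radialExtension_smul _ hr,
      det_fderiv_radialExtension (hs s) (hΦ.differentiable (by norm_num) _) (h0 s (hs s)),
      radialExtension_of_norm_eq_one (hs s), norm_smul, Real.norm_of_nonneg hr.le, ← hN]
    ring
  simp only [h1, h2]
  rw [integral_mul_const, integral_const, mappingDegree, average_eq, smul_eq_mul, smul_eq_mul]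
  have : (volume : Measure (EuclideanSpace ℝ (Fin 4))).toSphere.real univ ≠ 0 := by
    rw [measureReal_def, ENNReal.toReal_ne_zero]
    exact ⟨Measure.measure_univ_ne_zero.2 (Measure.toSphere_ne_zero _), measure_ne_top _ _⟩
  field_simp

end Density

/-! ### Maps fibred over the second coordinate -/

/-- The identification `ℂ² ≃ ℝ⁴` as a real linear equivalence. -/
noncomputable def planeEquiv : (ℂ × ℂ) ≃L[ℝ] EuclideanSpace ℝ (Fin 4) :=
  LinearEquiv.toContinuousLinearEquiv
    { toFun := fun p => toRealSpace ![p.1, p.2]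
      invFun := fun x => (toComplexPlane x 0, toComplexPlane x 1)
      map_add' := fun p q => by
        ext i; fin_cases i <;> simp [toRealSpace]
      map_smul' := fun r p => by
        ext i; fin_cases i <;> simp [toRealSpace]
      left_inv := fun p => by
        ext <;> simp [toRealSpace, toComplexPlane]
      right_inv := fun x => by
        ext i; fin_cases i <;> simp [toRealSpace, toComplexPlane] }

theorem planeEquiv_apply (p : ℂ × ℂ) : planeEquiv p = toRealSpace ![p.1, p.2] := rfl

theorem planeEquiv_symm_apply (x : EuclideanSpace ℝ (Fin 4)) :
    planeEquiv.symm x = (toComplexPlane x 0, toComplexPlane x 1) := rfl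

theorem norm_sq_planeEquiv (p : ℂ × ℂ) :
    ‖planeEquiv p‖ ^ 2 = normSq p.1 + normSq p.2 := by
  rw [EuclideanSpace.norm_sq_eq]
  simp [planeEquiv_apply, toRealSpace, Fin.sum_univ_four, normSq_apply]
  ring

/-- The product norm on `ℂ × ℂ` is the maximum norm, so the isometry argument passes through `WithLp
2`. -/
theorem measurePreserving_planeEquiv : MeasurePreserving (planeEquiv : ℂ × ℂ → _) := by
  let e : WithLp 2 (ℂ × ℂ) ≃ₗᵢ[ℝ] EuclideanSpace ℝ (Fin 4) :=
    { toLinearEquiv := (WithLp.linearEquiv 2 ℝ (ℂ × ℂ)).trans planeEquiv.toLinearEquiv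
      norm_map' := fun w => by
        rw [← sq_eq_sq₀ (norm_nonneg _) (norm_nonneg _), WithLp.prod_norm_sq_eq_of_L2,
          ← normSq_eq_norm_sq, ← normSq_eq_norm_sq]
        exact norm_sq_planeEquiv (w.fst, w.snd) }
  exact e.measurePreserving.comp (WithLp.volume_preserving_toLp ℂ ℂ)

theorem integral_planeEquiv {f : EuclideanSpace ℝ (Fin 4) → ℝ} (hf : Integrable f) :
    (∀ᵐ b : ℂ, Integrable fun z : ℂ => f (planeEquiv (z, b))) ∧
      ∫ x, f x = ∫ b : ℂ, ∫ z : ℂ, f (planeEquiv (z, b)) := by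
  have hemb : MeasurableEmbedding (planeEquiv : ℂ × ℂ → _) :=
    planeEquiv.toHomeomorph.measurableEmbedding
  have h1 : Integrable (fun p => f (planeEquiv p)) ((volume : Measure ℂ).prod volume) :=
    (measurePreserving_planeEquiv.integrable_comp_emb hemb).2 hf
  refine ⟨h1.prod_left_ae, ?_⟩
  rw [← measurePreserving_planeEquiv.integral_comp hemb, Measure.volume_eq_prod,
    integral_prod_symm _ h1]

/-- The matrix is block triangular, and the block of the second coordinate is `ε` times the identity
of `ℝ²`. -/
theorem det_eq_of_planeEquiv_fibered {A : EuclideanSpace ℝ (Fin 4) →L[ℝ] EuclideanSpace ℝ (Fin 4)}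
    {ε : ℝ} (hA : ∀ p, (planeEquiv.symm (A (planeEquiv p))).2 = ε * p.2) :
    A.det = ε ^ 2 * ((planeEquiv.symm (A (planeEquiv (1, 0)))).1.re *
        (planeEquiv.symm (A (planeEquiv (I, 0)))).1.im -
      (planeEquiv.symm (A (planeEquiv (1, 0)))).1.im *
        (planeEquiv.symm (A (planeEquiv (I, 0)))).1.re) := by
  have hb (p) : planeEquiv p = !₂[p.1.re, p.1.im, p.2.re, p.2.im] := rfl
  have hs0 (x) : (planeEquiv.symm x).1 = ⟨x 0, x 1⟩ := rfl
  have hs1 (x) : (planeEquiv.symm x).2 = ⟨x 2, x 3⟩ := rfl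
  have e0 : EuclideanSpace.single (0 : Fin 4) (1 : ℝ) = planeEquiv (1, 0) := by
    ext i; fin_cases i <;> simp [hb]
  have e1 : EuclideanSpace.single (1 : Fin 4) (1 : ℝ) = planeEquiv (I, 0) := by
    ext i; fin_cases i <;> simp [hb]
  have e2 : EuclideanSpace.single (2 : Fin 4) (1 : ℝ) = planeEquiv (0, 1) := by
    ext i; fin_cases i <;> simp [hb]
  have e3 : EuclideanSpace.single (3 : Fin 4) (1 : ℝ) = planeEquiv (0, I) := by
    ext i; fin_cases i <;> simp [hb]
  have h2 (p) : A (planeEquiv p) 2 = ε * p.2.re := by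
    have := congrArg Complex.re (hA p); simpa [hs1] using this
  have h3 (p) : A (planeEquiv p) 3 = ε * p.2.im := by
    have := congrArg Complex.im (hA p); simpa [hs1] using this
  rw [ContinuousLinearMap.det, ← LinearMap.det_toMatrix (EuclideanSpace.basisFun (Fin 4) ℝ).toBasis]
  have hM (i j) : LinearMap.toMatrix (EuclideanSpace.basisFun (Fin 4) ℝ).toBasis
      (EuclideanSpace.basisFun (Fin 4) ℝ).toBasis (A : _ →ₗ[ℝ] _) i j =
      A (EuclideanSpace.single j 1) i := by
    simp [LinearMap.toMatrix_apply]
  simp only [Matrix.det_succ_row_zero, Fin.sum_univ_succ, Matrix.submatrix_apply, hM, hs0]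
  simp [Fin.succAbove, e0, e1, e2, e3, h2, h3]
  ring

/-- The map `(z, b) ↦ (H (z, b), ε b)` in real coordinates. -/
noncomputable def fiberedMap (H : ℂ × ℂ → ℂ) (ε : ℝ) (x : EuclideanSpace ℝ (Fin 4)) :
    EuclideanSpace ℝ (Fin 4) :=
  planeEquiv (H (planeEquiv.symm x), ε * (planeEquiv.symm x).2)

section Fibered

variable {H : ℂ × ℂ → ℂ} {ε : ℝ}

theorem contDiff_fiberedMap {n : WithTop ℕ∞} (hH : ContDiff ℝ n H) :
    ContDiff ℝ n (fiberedMap H ε) := by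
  unfold fiberedMap
  have := planeEquiv.contDiff (n := n)
  have h2 := planeEquiv.symm.contDiff (n := n)
  exact this.comp ((hH.comp h2).prodMk (contDiff_const.mul (contDiff_snd.comp h2)))

theorem fiberedMap_ne_zero (hε : 0 < ε) (h0 : ∀ t, H (circleMap 0 1 t, 0) ≠ 0)
    (x : EuclideanSpace ℝ (Fin 4)) (hx : ‖x‖ = 1) : fiberedMap H ε x ≠ 0 := by
  obtain ⟨⟨z, b⟩, rfl⟩ := planeEquiv.surjective x
  intro h
  simp only [fiberedMap, map_eq_zero_iff planeEquiv planeEquiv.injective, Prod.mk_eq_zero,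
    ContinuousLinearEquiv.symm_apply_apply, mul_eq_zero, ofReal_eq_zero, hε.ne', false_or] at h
  obtain ⟨h1, rfl⟩ := h
  have h2 := norm_sq_planeEquiv (z, 0)
  rw [hx] at h2
  have h3 : ‖z‖ = 1 := by
    rw [← sq_eq_sq₀ (norm_nonneg _) zero_le_one, ← normSq_eq_norm_sq]
    simpa using h2.symm
  refine h0 (arg z) ?_
  rwa [show circleMap 0 1 (arg z) = z by
    have := norm_mul_exp_arg_mul_I z
    rw [h3] at this
    simpa [circleMap] using this]

/-- The restriction to the line through `(0, b)` of the first coordinate of the homogeneous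
extension of `fiberedMap H ε`. -/
noncomputable def fiberMap (H : ℂ × ℂ → ℂ) (ε : ℝ) (b z : ℂ) : ℂ :=
  (planeEquiv.symm (radialExtension (fiberedMap H ε) (planeEquiv (z, b)))).1

theorem fiberMap_eq (b z : ℂ) : fiberMap H ε b z = (‖planeEquiv (z, b)‖ : ℂ) *
    H (z / ‖planeEquiv (z, b)‖, b / ‖planeEquiv (z, b)‖) := by
  simp only [fiberMap, radialExtension, fiberedMap, map_smul,
    ContinuousLinearEquiv.symm_apply_apply, Prod.smul_mk, real_smul, ofReal_inv]
  simp only [div_eq_inv_mul]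

/-- Being linear, the second coordinate is unchanged by the homogeneous extension. This keeps the
extension fibred and makes Fubini applicable. -/
theorem planeEquiv_symm_radialExtension_snd (p : ℂ × ℂ) :
    (planeEquiv.symm (radialExtension (fiberedMap H ε) (planeEquiv p))).2 = ε * p.2 := by
  rcases eq_or_ne p 0 with rfl | hp
  · simp [radialExtension]
  have : (‖planeEquiv p‖ : ℂ) ≠ 0 := by simpa using hp
  simp only [radialExtension, fiberedMap, map_smul, ContinuousLinearEquiv.symm_apply_apply,
    Prod.smul_snd, real_smul, ofReal_inv]
  field_simp

theorem radialExtension_fiberedMap (b z : ℂ) :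
    radialExtension (fiberedMap H ε) (planeEquiv (z, b)) =
      planeEquiv (fiberMap H ε b z, ε * b) := by
  rw [← ContinuousLinearEquiv.symm_apply_eq]
  exact Prod.ext rfl (planeEquiv_symm_radialExtension_snd (z, b))

/-- For `b ≠ 0` the plane `z ↦ (z, b)` avoids the origin, the only point where the extension may
fail to be smooth. -/
theorem contDiff_fiberMap (hH : ContDiff ℝ 2 H) {b : ℂ} (hb : b ≠ 0) :
    ContDiff ℝ 2 (fiberMap H ε b) := by
  have h1 := contDiffOn_radialExtension (contDiff_fiberedMap (ε := ε) hH)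
  have h2 : ContDiff ℝ 2 fun z : ℂ => planeEquiv (z, b) :=
    planeEquiv.contDiff.comp (contDiff_id.prodMk contDiff_const)
  have h3 : ContDiff ℝ 2 fun z : ℂ => radialExtension (fiberedMap H ε) (planeEquiv (z, b)) :=
    h1.comp_contDiff h2 fun z => by simp [hb]
  exact contDiff_fst.comp (planeEquiv.symm.contDiff.comp h3)

theorem det_fderiv_radialExtension_fiberedMap (hH : ContDiff ℝ 2 H) {b : ℂ} (hb : b ≠ 0) (z : ℂ) :
    (fderiv ℝ (radialExtension (fiberedMap H ε)) (planeEquiv (z, b))).det =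
      ε ^ 2 * planarJacobian (fiberMap H ε b) z := by
  set A := fderiv ℝ (radialExtension (fiberedMap H ε)) (planeEquiv (z, b)) with hA
  have hne : planeEquiv (z, b) ≠ 0 := by simp [hb]
  have hd : HasFDerivAt (radialExtension (fiberedMap H ε)) A (planeEquiv (z, b)) :=
    (((contDiffOn_radialExtension (contDiff_fiberedMap (ε := ε) hH)).contDiffAt
      (isOpen_compl_singleton.mem_nhds hne)).differentiableAt (by norm_num)).hasFDerivAt
  have hP : HasFDerivAt (fun p => planeEquiv.symm (radialExtension (fiberedMap H ε)
      (planeEquiv p))) ((planeEquiv.symm : _ →L[ℝ] ℂ × ℂ).comp (A.comp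
        (planeEquiv : ℂ × ℂ →L[ℝ] _))) (z, b) :=
    planeEquiv.symm.hasFDerivAt.comp _ (hd.comp _ planeEquiv.hasFDerivAt)
  have h2 : (ContinuousLinearMap.snd ℝ ℂ ℂ).comp ((planeEquiv.symm : _ →L[ℝ] ℂ × ℂ).comp (A.comp
        (planeEquiv : ℂ × ℂ →L[ℝ] _))) = ε • ContinuousLinearMap.snd ℝ ℂ ℂ := by
    have h3 : HasFDerivAt (fun p : ℂ × ℂ => (ε : ℂ) * p.2) (ε • ContinuousLinearMap.snd ℝ ℂ ℂ)
        (z, b) := by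
      simpa using! (hasFDerivAt_snd (𝕜 := ℝ) (p := (z, b))).const_smul ε
    refine HasFDerivAt.unique ?_ h3
    exact (hP.snd).congr_of_eventuallyEq
      (Eventually.of_forall fun p => (planeEquiv_symm_radialExtension_snd p).symm)
  have h1 (v : ℂ) : fderiv ℝ (fiberMap H ε b) z v =
      (planeEquiv.symm (A (planeEquiv (v, 0)))).1 := by
    have h4 : HasFDerivAt (fun z : ℂ => (z, b)) (ContinuousLinearMap.inl ℝ ℂ ℂ) z :=
      hasFDerivAt_prodMk_left z b
    have h5 := (HasFDerivAt.comp z hP h4).fst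
    have h6 : fderiv ℝ (fiberMap H ε b) z = _ := h5.fderiv
    rw [h6]
    rfl
  rw [det_eq_of_planeEquiv_fibered (ε := ε), planarJacobian, h1, h1]
  intro p
  have := congrArg (fun L : ℂ × ℂ →L[ℝ] ℂ => L p) h2
  simpa using this

/-- On the circle `|z| = R` the norm of `(z, b)` is the constant `N = √(R² + |b|²)`, so the image
loop is `N` times the loop of `H` at radius `R / N` and second coordinate `b / N`. These tend to `1`
and `0`, so the limiting loop does not depend on `b`. -/
theorem integral_fiber (hH : ContDiff ℝ 2 H)
    (h0 : ∀ t, H (circleMap 0 1 t, 0) ≠ 0) {b : ℂ} (hb : b ≠ 0) {B : ℝ} (hB : 0 < B)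
    (hint : Integrable fun z => ((B + normSq (fiberMap H ε b z)) ^ 3)⁻¹ *
      planarJacobian (fiberMap H ε b) z) :
    ∫ z, ((B + normSq (fiberMap H ε b z)) ^ 3)⁻¹ * planarJacobian (fiberMap H ε b) z =
      (4 * B ^ 2)⁻¹ * ∫ t in (-Real.pi)..Real.pi,
        angularSpeed (fun t => H (circleMap 0 1 t, 0)) t := by
  refine integral_radialDensity_plane (contDiff_fiberMap hH hb) hB hint ?_
  set N : ℝ → ℝ := fun R => √(R ^ 2 + normSq b) with hN
  have hbpos : 0 < normSq b := normSq_pos.2 hb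
  have hNpos (R) : 0 < N R := Real.sqrt_pos.2 (by positivity)
  have hnorm (R t : ℝ) : ‖planeEquiv (circleMap 0 R t, b)‖ = N R := by
    have := norm_sq_planeEquiv (circleMap 0 R t, b)
    rw [hN, ← Real.sqrt_sq (norm_nonneg (planeEquiv _)), this]
    simp [normSq_eq_norm_sq]
  have hloop (R : ℝ) : (fun t => fiberMap H ε b (circleMap 0 R t)) =
      fun t => (N R : ℂ) * H (circleMap 0 (R / N R) t, b / N R) := by
    ext t
    rw [fiberMap_eq, hnorm]
    congr 3
    simp [circleMap]
    ring
  have hNtop : Tendsto N atTop atTop := by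
    refine tendsto_atTop_mono (fun R => ?_) tendsto_id
    exact Real.le_sqrt_of_sq_le (by simp only [id]; linarith)
  have hNinv : Tendsto (fun R => (N R)⁻¹) atTop (𝓝 0) := hNtop.inv_tendsto_atTop
  have hsq : Tendsto (fun R => (N R ^ 2)⁻¹) atTop (𝓝 0) := by
    simpa using hNinv.pow 2
  have hRN : Tendsto (fun R => R / N R) atTop (𝓝 1) := by
    have h1 : Tendsto (fun R => √(1 - normSq b * (N R ^ 2)⁻¹)) atTop (𝓝 1) := by
      simpa using ((hsq.const_mul (normSq b)).const_sub 1).sqrt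
    refine h1.congr' ?_
    filter_upwards [eventually_ge_atTop 0] with R hR
    rw [← Real.sqrt_sq (div_nonneg hR (hNpos R).le), div_pow]
    congr 1
    have h2 : N R ^ 2 = R ^ 2 + normSq b := Real.sq_sqrt (by positivity)
    have := hNpos R
    field_simp
    linarith
  have hbN : Tendsto (fun R => b / (N R : ℂ)) atTop (𝓝 0) := by
    have h1 : Tendsto (fun R => ((N R)⁻¹ : ℝ) • b) atTop (𝓝 ((0 : ℝ) • b)) :=
      hNinv.smul_const b
    rw [zero_smul] at h1
    refine h1.congr fun R => ?_
    simp [div_eq_inv_mul]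
  have key := (tendsto_integral_scaledFlux hH h0 hB.ne').comp
    (hsq.prodMk_nhds (hRN.prodMk_nhds hbN))
  refine key.congr fun R => ?_
  simp only [Function.comp_def, hloop, fluxIntegrand_smul (hNpos R)]

theorem integral_density_fiberedMap (hH : ContDiff ℝ 2 H) (hε : 0 < ε)
    (h0 : ∀ t, H (circleMap 0 1 t, 0) ≠ 0) :
    ∫ x, ((1 + ‖radialExtension (fiberedMap H ε) x‖ ^ 2) ^ 3)⁻¹ *
        (fderiv ℝ (radialExtension (fiberedMap H ε)) x).det =
      (∫ b : ℂ, (4 * (1 + normSq b) ^ 2)⁻¹) *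
        ∫ t in (-Real.pi)..Real.pi, angularSpeed (fun t => H (circleMap 0 1 t, 0)) t := by
  obtain ⟨hfib, hint⟩ := integral_planeEquiv (integrable_density_radialExtension
    ((contDiff_fiberedMap (ε := ε) hH).of_le (by norm_num)) (fiberedMap_ne_zero hε h0))
  rw [hint]
  set W := ∫ t in (-Real.pi)..Real.pi, angularSpeed (fun t => H (circleMap 0 1 t, 0)) t
  have hne : ∀ᵐ b : ℂ, b ≠ 0 := Measure.ae_ne volume 0
  have h1 : ∀ᵐ b : ℂ, (∫ z : ℂ, ((1 + ‖radialExtension (fiberedMap H ε)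
        (planeEquiv (z, b))‖ ^ 2) ^ 3)⁻¹ *
        (fderiv ℝ (radialExtension (fiberedMap H ε)) (planeEquiv (z, b))).det) =
      ε ^ 2 * ((4 * (1 + normSq (ε • b)) ^ 2)⁻¹ * W) := by
    filter_upwards [hfib, hne] with b hb1 hb
    have hpt (z : ℂ) : ((1 + ‖radialExtension (fiberedMap H ε)
        (planeEquiv (z, b))‖ ^ 2) ^ 3)⁻¹ *
        (fderiv ℝ (radialExtension (fiberedMap H ε)) (planeEquiv (z, b))).det =
        ε ^ 2 * ((((1 + normSq (ε • b)) + normSq (fiberMap H ε b z)) ^ 3)⁻¹ *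
          planarJacobian (fiberMap H ε b) z) := by
      rw [det_fderiv_radialExtension_fiberedMap hH hb, radialExtension_fiberedMap,
        norm_sq_planeEquiv, mul_left_comm, real_smul, add_assoc, add_comm (normSq (ε * b))]
    simp only [hpt] at hb1 ⊢
    rw [integral_const_mul, integral_fiber hH h0 hb
      (add_pos_of_pos_of_nonneg one_pos (normSq_nonneg _))]
    refine (hb1.const_mul (ε ^ 2)⁻¹).congr (ae_of_all _ fun z => ?_)
    field_simp
  -- The substitution `b ↦ ε b` on the real plane absorbs the factor `ε ^ 2`.
  rw [integral_congr_ae h1, integral_const_mul, integral_mul_const,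
    Measure.integral_comp_smul volume (fun b : ℂ => (4 * (1 + normSq b) ^ 2)⁻¹) ε]
  rw [finrank_real_complex, abs_of_pos (by positivity), smul_eq_mul]
  field_simp

theorem integral_angularSpeed_circleMap :
    ∫ t in (-Real.pi)..Real.pi, angularSpeed (circleMap 0 1) t = 2 * Real.pi := by
  have h (t) : angularSpeed (circleMap 0 1) t = 1 := by
    have h1 : normSq (circleMap 0 1 t) = 1 := by simp [normSq_eq_norm_sq]
    have h2 := normSq_apply (circleMap 0 1 t)
    rw [angularSpeed, h1, deriv_circleMap]
    simp only [mul_re, mul_im, I_re, I_im]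
    linarith
  simp only [h]
  simp
  ring

/-- For `H = Prod.fst` and `ε = 1` the extension is the identity and the loop is the unit circle.
This fixes the normalizing constant without evaluating either integral. -/
theorem integral_inv_one_add_norm_sq_pow :
    ∫ x : EuclideanSpace ℝ (Fin 4), ((1 + ‖x‖ ^ 2) ^ 3)⁻¹ =
      (∫ b : ℂ, (4 * (1 + normSq b) ^ 2)⁻¹) * (2 * Real.pi) := by
  have h1 := integral_density_fiberedMap (H := Prod.fst) contDiff_fst one_pos
    (fun t => by simp)
  have hid : fiberedMap Prod.fst 1 = id := by
    ext1 x
    simp [fiberedMap]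
  have h2 : radialExtension (fiberedMap Prod.fst 1) = id := by
    ext1 x
    rcases eq_or_ne x 0 with rfl | hx
    · simp [radialExtension]
    have : ‖x‖ ≠ 0 := norm_ne_zero_iff.2 hx
    simp [radialExtension, hid, smul_smul, this]
  rw [h2, integral_angularSpeed_circleMap] at h1
  rw [← h1]
  simp [ContinuousLinearMap.det]

theorem mappingDegree_fiberedMap (hH : ContDiff ℝ 2 H) (hε : 0 < ε)
    (h0 : ∀ t, H (circleMap 0 1 t, 0) ≠ 0) :
    mappingDegree (fun x => ‖fiberedMap H ε x‖⁻¹ • fiberedMap H ε x) * (2 * Real.pi) =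
      ∫ t in (-Real.pi)..Real.pi, angularSpeed (fun t => H (circleMap 0 1 t, 0)) t := by
  have h1 := integral_density_radialExtension
    ((contDiff_fiberedMap (ε := ε) hH).of_le (by norm_num)) (fiberedMap_ne_zero hε h0)
  rw [integral_density_fiberedMap hH hε h0, integral_inv_one_add_norm_sq_pow] at h1
  have hpos : 0 < ∫ x : EuclideanSpace ℝ (Fin 4), ((1 + ‖x‖ ^ 2) ^ 3)⁻¹ := by
    rw [integral_pos_iff_support_of_nonneg (fun x => by positivity)
      integrable_inv_one_add_norm_sq_pow]
    rw [show Function.support (fun x : EuclideanSpace ℝ (Fin 4) => ((1 + ‖x‖ ^ 2) ^ 3)⁻¹) = univ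
      from eq_univ_of_forall fun x => by
        rw [Function.mem_support]; positivity]
    simp
  rw [integral_inv_one_add_norm_sq_pow] at hpos
  have hQ : (∫ b : ℂ, (4 * (1 + normSq b) ^ 2)⁻¹) ≠ 0 := by
    intro h; rw [h, zero_mul] at hpos; exact lt_irrefl _ hpos
  refine mul_left_cancel₀ hQ ?_
  linarith

end Fibered

/-! ### Mixed polynomials and the conclusion -/

theorem MixedPolynomial.contDiff_value {n : ℕ} (F : MixedPolynomial n) {k : WithTop ℕ∞} :
    ContDiff ℝ k fun z : Fin n → ℂ => F.value z := by
  unfold MixedPolynomial.value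
  induction F using MvPolynomial.induction_on with
  | C a => simpa using contDiff_const
  | add p q hp hq => simpa using hp.add hq
  | mul_X p i hp =>
    simp only [map_mul, MvPolynomial.eval_X]
    refine hp.mul ?_
    cases i with
    | inl j => exact contDiff_apply ℝ ℂ j
    | inr j => exact conjCLE.contDiff.comp (contDiff_apply ℝ ℂ j)

theorem MixedPolynomial.value_restrictLine (F : MixedPolynomial 2) (z : ℂ) :
    F.restrictLine.value ![z] = F.value ![z, 0] := by
  rw [MixedPolynomial.value, MixedPolynomial.restrictLine, ← MvPolynomial.aeval_eq_eval,
    MvPolynomial.aeval_bind₁, MvPolynomial.aeval_eq_eval, MixedPolynomial.value]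
  congr 2
  ext i
  rcases i with j | j <;> fin_cases j <;> simp

theorem MixedPolynomial.value_z₂ (z : Fin 2 → ℂ) : MixedPolynomial.z₂.value z = z 1 := by
  simp [MixedPolynomial.value, MixedPolynomial.z₂]

/-- All common zeros lie on the line `z₂ = 0`, which is embedded isometrically, so the ball meets it
in the disk of the same radius. -/
theorem isOnlyIntersection_z₂_iff {F : MixedPolynomial 2} {α : ℂ} {ε : ℝ} :
    IsOnlyIntersection F MixedPolynomial.z₂ ![α, 0] ε ↔ IsOnlyRoot F.restrictLine α ε := by
  have hα : toRealSpace ![α, 0] = planeEquiv (α, 0) := rfl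
  have hval (p : ℂ × ℂ) : toComplexPlane (planeEquiv p) = ![p.1, p.2] := by
    ext i
    fin_cases i <;> simp [planeEquiv_apply, toRealSpace, toComplexPlane]
  have hdist (z : ℂ) : dist (planeEquiv (z, 0)) (planeEquiv (α, 0)) = dist z α := by
    rw [dist_eq_norm, dist_eq_norm, ← map_sub, ← sq_eq_sq₀ (norm_nonneg _) (norm_nonneg _),
      norm_sq_planeEquiv, ← normSq_eq_norm_sq]
    simp
  have hmem (p : ℂ × ℂ) : toComplexPlane (planeEquiv p) ∈
      F.zeroSet ∩ MixedPolynomial.z₂.zeroSet ↔ F.restrictLine.value ![p.1] = 0 ∧ p.2 = 0 := by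
    rw [hval, MixedPolynomial.value_restrictLine, mem_inter_iff]
    change F.value ![p.1, p.2] = 0 ∧ MixedPolynomial.z₂.value ![p.1, p.2] = 0 ↔ _
    rw [MixedPolynomial.value_z₂]
    refine and_congr_left fun hp => ?_
    have hp : p.2 = 0 := hp
    rw [hp]
  constructor
  · intro h z hz
    have := h (planeEquiv (z, 0)) (by rw [hα, Metric.mem_closedBall, hdist]; exact hz)
    rw [hmem, hα, planeEquiv.injective.eq_iff] at this
    simpa using this
  · intro h x hx
    obtain ⟨⟨z, b⟩, rfl⟩ := planeEquiv.surjective x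
    rw [hmem, hα, planeEquiv.injective.eq_iff]
    rw [Prod.mk.injEq]
    refine and_congr_left fun hb => h z ?_
    obtain rfl : b = 0 := hb
    rwa [hα, Metric.mem_closedBall, hdist] at hx

theorem mainTheorem6 (F : MixedPolynomial 2) (α : ℂ)
    (hroot : F.restrictLine.value ![α] = 0)
    (hisolated : ∀ᶠ z in nhdsWithin α {α}ᶜ, F.restrictLine.value ![z] ≠ 0) :
    ![α, 0] ∈ F.zeroSet ∩ MixedPolynomial.z₂.zeroSet ∧
      ∃ n : ℤ, HasIntersectionNumber F MixedPolynomial.z₂ ![α, 0] n ∧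
        HasSignedMultiplicity F.restrictLine α n := by
  refine ⟨⟨?_, ?_⟩, ?_⟩
  · change F.value ![α, 0] = 0
    rw [← F.value_restrictLine, hroot]
  · change MixedPolynomial.z₂.value ![α, 0] = 0
    simp [MixedPolynomial.value_z₂]
  have hex : ∃ ε > 0, IsOnlyRoot F.restrictLine α ε := by
    rw [eventually_nhdsWithin_iff, Metric.eventually_nhds_iff_ball] at hisolated
    obtain ⟨δ, hδ, h⟩ := hisolated
    refine ⟨δ / 2, half_pos hδ, fun z hz => ⟨fun hz0 => ?_, fun hz0 => hz0 ▸ hroot⟩⟩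
    by_contra hne
    exact h z (Metric.closedBall_subset_ball (half_lt_self hδ) hz) hne hz0
  set f : ℂ → ℂ := fun z => F.restrictLine.value ![z] with hf
  have hfc : ContDiff ℝ 2 f := F.restrictLine.contDiff_value.comp
    (contDiff_pi.2 fun i => by fin_cases i; exact contDiff_id)
  set S : Set ℝ := {ε | 0 < ε ∧ IsOnlyRoot F.restrictLine α ε} with hS
  -- Any smaller positive radius is again admissible, so `S` is an interval.
  have hSconn : IsPreconnected S := by
    refine (Set.OrdConnected.isPreconnected ⟨fun x hx y hy r hr => ?_⟩)
    exact ⟨hx.1.trans_le hr.1, fun z hz => hy.2 z (Metric.closedBall_subset_closedBall hr.2 hz)⟩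
  have hS0 : ∀ r ∈ S, ∀ t, f (circleMap α r t) ≠ 0 := by
    intro r hr t h
    have h1 := (hr.2 _ (circleMap_mem_closedBall α hr.1.le t)).1 h
    exact circleMap_ne_center hr.1.ne' h1
  obtain ⟨n, hn⟩ := exists_forall_winding hfc hSconn hS0
  refine ⟨n, ⟨?_, fun ε hε h => ?_⟩, hex, fun ε hε h => (hn ε ⟨hε, h⟩).2⟩
  · simpa only [isOnlyIntersection_z₂_iff] using hex
  rw [isOnlyIntersection_z₂_iff] at h
  -- Moving the sphere around `(α, 0)` to the unit sphere turns `(F, z₂)` into `(H, ε b)`, and the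
  -- loop of `H` on the unit circle `b = 0` is that of `f` on the circle of radius `ε`.
  set H : ℂ × ℂ → ℂ := fun p => F.value ![α + ε * p.1, ε * p.2] with hH
  have hHc : ContDiff ℝ 2 H := by
    refine F.contDiff_value.comp (contDiff_pi.2 fun i => ?_)
    fin_cases i
    · exact contDiff_const.add (contDiff_const.mul contDiff_fst)
    · exact contDiff_const.mul contDiff_snd
  have hloop (t : ℝ) : H (circleMap 0 1 t, 0) = f (circleMap α ε t) := by
    simp only [hH, hf, F.value_restrictLine, mul_zero]
    simp [circleMap]
  have hnorm : normalizedPair F MixedPolynomial.z₂ ![α, 0] ε =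
      fun x => ‖fiberedMap H ε x‖⁻¹ • fiberedMap H ε x := by
    have hx (x) : realPair F MixedPolynomial.z₂ (toRealSpace ![α, 0] + ε • x) =
        fiberedMap H ε x := by
      have h1 : toComplexPlane (toRealSpace ![α, 0] + ε • x) =
          ![α + ε * (planeEquiv.symm x).1, ε * (planeEquiv.symm x).2] := by
        ext i
        fin_cases i <;> simp [toComplexPlane, toRealSpace, planeEquiv_symm_apply, Complex.ext_iff]
      rw [realPair, h1, MixedPolynomial.value_z₂]
      rfl
    ext1 x
    simp only [normalizedPair, hx]
  have hdeg := mappingDegree_fiberedMap hHc hε (fun t => by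
    rw [hloop]; exact hS0 ε ⟨hε, h⟩ t)
  simp only [hloop, (hn ε ⟨hε, h⟩).1] at hdeg
  rw [hnorm]
  refine mul_right_cancel₀ (b := 2 * Real.pi) (by positivity) ?_
  rw [hdeg, mul_comm]
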